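/- **Conventions.** A half-integer is an element of $\frac12+\mathbb Z$. An $n$-partition (respectively $n$-half-partition) is a vector $\lambda_1\ge\dots\ge\lambda_n\ge 0$ of integers (respectively of half-integers). We write $u^{(k)}=(u,\dots,u)$ ($k$ entries). A sum over $\lambda\subseteq u^{(m)}$ runs over all $m$-partitions (if $u\in\mathbb Z$) or all $m$-half-partitions (if $u\in\frac12+\mathbb Z$) with all $\lambda_i\le u$; $(u^{(n-m)},\lambda)$ denotes concatenation. A *half-triangular array* of height $N$ is $z=(z_{i,j})_{1\le i\le N,\,1\le j\le\lceil i/2\rceil}$; it is *interlacing* if $z_{i+1,j+1}\le z_{i,j}\le z_{i+1,j}$ whenever the entries involved exist. Its shape is its bottom row, and $\mathrm{type}(z)_i=\sum_{j}z_{i,j}-\sum_j z_{i-1,j}$ (with an empty $0$-th row). A *symplectic pattern* is an interlacing half-triangular array with entries in $\mathbb Z_{\ge0}$; $\mathrm{spGT}^{(N)}_\lambda$ is the set of those of height $N$ and shape $\lambda$. A *split orthogonal pattern* of height $2n$ is an interlacing half-triangular array whose odd ends $z_{2i-1,i}$ ($1\le i\le n$) lie in $\frac12\mathbb Z_{\ge0}$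 and whose other entries are either all in $\mathbb Z_{\ge0}$ or all in $\frac12+\mathbb Z_{\ge0}$; $\mathrm{soGT}^{(2n)}_\lambda$ is the set of those of shape $\lambda$. If $z_{2n,1}$ is an integer (respectively a half-integer), the half-integer (respectively integer) entries of $z$ are called atypical, and $|\mathrm{atyp}(z)|$ is their number. For $x=(x_1,\dots,x_n)$, with $w_z(x)=\prod_{i=1}^n x_i^{\mathrm{type}(z)_{2i}-\mathrm{type}(z)_{2i-1}}$, put $$\mathrm{trans}_\lambda(x;\beta)=\sum_{z\in\mathrm{soGT}^{(2n)}_\lambda}\beta^{|\mathrm{atyp}(z)|}w_z(x),\qquad \mathrm{so}^{(2n+1)}_\lambda(x)=\sum_{z\in\mathrm{soGT}^{(2n)}_\lambda}w_z(x),$$ $$\mathrm{sp}^{(2n)}_\lambda(x)=\sum_{z\in\mathrm{spGT}^{(2n)}_\lambda}w_z(x),\qquad \mathrm{sp}^{(2n+1)}_\lambda(x;s)=\sum_{z\in\mathrm{spGT}^{(2n+1)}_\lambda}w_z(x)\,s^{\mathrm{type}(z)_{2n+1}}.$$ These are Laurent polynomials in (the square roots of) the variables over a commutative ring containing $\beta$;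 $\mathrm{trans}_\lambda$ is the $\mathrm{CB}$-interpolating Schur polynomial, and the others are the odd orthogonal, even symplectic and odd symplectic Schur polynomials. **Theorem.** Let $n\ge m\ge1$ be integers, $x=(x_1,\dots,x_n)$, $y=(y_1,\dots,y_m)$, and let $s$ be one further variable. Then $$\mathrm{trans}_{u^{(n+m)}}(x,y;\beta)=\sum_{\lambda\subseteq u^{(m)}}\mathrm{trans}_{(u^{(n-m)},\lambda)}(x;\beta)\,\mathrm{trans}_\lambda(y;\beta),\qquad u\in\tfrac12\mathbb Z_{\ge0}.$$ In particular, for $\beta=0$ and $\beta=1$, $$\mathrm{sp}^{(2n+2m)}_{u^{(n+m)}}(x,y)=\sum_{\lambda\subseteq u^{(m)}}\mathrm{sp}^{(2n)}_{(u^{(n-m)},\lambda)}(x)\,\mathrm{sp}^{(2m)}_\lambda(y),\qquad u\in\mathbb Z_{\ge0},$$ $$\mathrm{so}^{(2n+2m+1)}_{u^{(n+m)}}(x,y)=\sum_{\lambda\subseteq u^{(m)}}\mathrm{so}^{(2n+1)}_{(u^{(n-m)},\lambda)}(x)\,\mathrm{so}^{(2m+1)}_\lambda(y),\qquad u\in\tfrac12\mathbb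 Z_{\ge0}.$$ Moreover, $$\mathrm{sp}^{(2n+2m+2)}_{u^{(n+m+1)}}(x,y,s)=s^{-u}\sum_{\lambda\subseteq u^{(m+1)}}\mathrm{sp}^{(2n+1)}_{(u^{(n-m)},\lambda)}(x;s)\,\mathrm{sp}^{(2m+1)}_\lambda(y;s),\qquad u\in\mathbb Z_{\ge0}.$$ -/

import Mathlib

open scoped BigOperators

noncomputable section

namespace CBSchur

/-! ### Integers, half-integers and (half-)partitions -/

/-- `q` is a non-negative integer. -/
def IsNonnegInt (q : ℚ) : Prop := ∃ k : ℕ, q = k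

/-- `q` is a non-negative half-integer, that is, `q ∈ 1/2 + ℤ_{≥ 0}`. -/
def IsNonnegHalfInt (q : ℚ) : Prop := ∃ k : ℕ, q = k + 1 / 2

/-- `q ∈ (1/2) ℤ_{≥ 0}`. -/
def IsHalfNat (q : ℚ) : Prop := ∃ k : ℕ, q = k / 2

/-- `n`-partitions: weakly decreasing vectors of `n` non-negative integers. -/
def IsPartition {n : ℕ} (lam : Fin n → ℚ) : Prop :=
  Antitone lam ∧ ∀ i, IsNonnegInt (lam i)

/-- `n`-half-partitions: weakly decreasing vectors of `n` non-negative half-integers. -/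
def IsHalfPartition {n : ℕ} (lam : Fin n → ℚ) : Prop :=
  Antitone lam ∧ ∀ i, IsNonnegHalfInt (lam i)

/-- The index set of a sum over `lam ⊆ mu`: all partitions (respectively, half-partitions) `lam`
with `lam_i ≤ mu_i` for all `i`, if `mu` is a partition (respectively, a half-partition). -/
def subPartitions {n : ℕ} (mu : Fin n → ℚ) : Set (Fin n → ℚ) :=
  {lam | ((IsPartition mu ∧ IsPartition lam) ∨ (IsHalfPartition mu ∧ IsHalfPartition lam)) ∧
    ∀ i, lam i ≤ mu i}

/-- The vector `u^{(n)} = (u, …, u)` with `n` components. -/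
def rect (n : ℕ) (u : ℚ) : Fin n → ℚ := fun _ => u

/-- The vector `(u^{(k)}, lam)`, of length `n = k + l`. -/
def prependRect {k l n : ℕ} (h : n = k + l) (u : ℚ) (lam : Fin l → ℚ) : Fin n → ℚ :=
  fun i => Fin.append (rect k u) lam (Fin.cast h i)

/-! ### Half-triangular patterns

A half-triangular array `(z_{i,j})`, `1 ≤ i ≤ N`, `1 ≤ j ≤ ⌈i/2⌉`, is represented by a function
`z : ℕ → ℕ → ℚ` which vanishes outside these indices. -/

/-- The index set of half-triangular arrays of height `N`; here `(i + 1) / 2 = ⌈i/2⌉`. -/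
def Idx (N i j : ℕ) : Prop := 1 ≤ i ∧ i ≤ N ∧ 1 ≤ j ∧ j ≤ (i + 1) / 2

/-- The array `z` has no entries outside the index set. -/
def IsArray (N : ℕ) (z : ℕ → ℕ → ℚ) : Prop := ∀ i j, ¬ Idx N i j → z i j = 0

/-- The interlacing conditions `z_{i+1,j+1} ≤ z_{i,j} ≤ z_{i+1,j}`, whenever both entries of the
inequality belong to the array. -/
def Interlacing (N : ℕ) (z : ℕ → ℕ → ℚ) : Prop :=
  (∀ i j, Idx N i j → Idx N (i + 1) j → z i j ≤ z (i + 1) j) ∧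
  (∀ i j, Idx N i j → Idx N (i + 1) (j + 1) → z (i + 1) (j + 1) ≤ z i j)

/-- The shape (bottom row) of the array `z` of height `N` is `lam`, where `l = ⌈N/2⌉`. -/
def HasShape (N : ℕ) {l : ℕ} (lam : Fin l → ℚ) (z : ℕ → ℕ → ℚ) : Prop :=
  ∀ j : Fin l, z N (j + 1) = lam j

/-- The sum of the `i`-th row. -/
def rowSum (z : ℕ → ℕ → ℚ) (i : ℕ) : ℚ := ∑ j ∈ Finset.Icc 1 ((i + 1) / 2), z i j

/-- The `i`-th entry of the type of `z`, for `i ≥ 1`. -/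
def rowType (z : ℕ → ℕ → ℚ) (i : ℕ) : ℚ := rowSum z i - rowSum z (i - 1)

/-- Symplectic patterns of height `N` and shape `lam`, where `l = ⌈N/2⌉`. -/
def spGT (N : ℕ) {l : ℕ} (lam : Fin l → ℚ) : Set (ℕ → ℕ → ℚ) :=
  {z | IsArray N z ∧ (∀ i j, Idx N i j → IsNonnegInt (z i j)) ∧ Interlacing N z ∧
    HasShape N lam z}

/-- `(i, j)` is the position of an odd end, that is, `(i, j) = (2 k - 1, k)` for some `k`. -/
def IsOddEnd (i j : ℕ) : Prop := i + 1 = 2 * j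

/-- Split orthogonal patterns of height `2 n` and shape `lam`. -/
def soGT (n : ℕ) (lam : Fin n → ℚ) : Set (ℕ → ℕ → ℚ) :=
  {z | IsArray (2 * n) z ∧
    (∀ i j, Idx (2 * n) i j → IsOddEnd i j → IsHalfNat (z i j)) ∧
    ((∀ i j, Idx (2 * n) i j → ¬ IsOddEnd i j → IsNonnegInt (z i j)) ∨
      (∀ i j, Idx (2 * n) i j → ¬ IsOddEnd i j → IsNonnegHalfInt (z i j))) ∧
    Interlacing (2 * n) z ∧ HasShape (2 * n) lam z}

/-- The entry `z_{i,j}` is atypical: it is a half-integer while `z_{2n,1}` is an integer, or it is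
an integer while `z_{2n,1}` is a half-integer. -/
def IsAtypical (n : ℕ) (z : ℕ → ℕ → ℚ) (i j : ℕ) : Prop :=
  (IsNonnegInt (z (2 * n) 1) ∧ IsNonnegHalfInt (z i j)) ∨
    (IsNonnegHalfInt (z (2 * n) 1) ∧ IsNonnegInt (z i j))

open Classical in
/-- The number of atypical entries; in a split orthogonal pattern only odd ends
`z_{2k-1,k}`, `1 ≤ k ≤ n`, can be atypical. -/
def atypCount (n : ℕ) (z : ℕ → ℕ → ℚ) : ℕ :=
  ((Finset.Icc 1 n).filter fun k => IsAtypical n z (2 * k - 1) k).card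

/-! ### Finiteness of the index sets of the sums -/

theorem finite_of_bounded (N K : ℕ) (S : Set (ℕ → ℕ → ℚ))
    (h : ∀ z ∈ S, IsArray N z ∧ ∀ i j, Idx N i j → ∃ k : ℕ, k < K ∧ z i j = k / 2) :
    S.Finite := by
  classical
  refine (Set.finite_range (fun (f : Fin (N + 1) → Fin (N + 2) → Fin (K + 1)) (i j : ℕ) =>
    if hij : i < N + 1 ∧ j < N + 2 then (((f ⟨i, hij.1⟩ ⟨j, hij.2⟩ : ℕ) : ℚ) / 2) else 0)).subset ?_
  intro z hz
  obtain ⟨h0, h1⟩ := h z hz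
  have h2 : ∀ i j, ∃ k : ℕ, k < K + 1 ∧ z i j = k / 2 := by
    intro i j
    by_cases hi : Idx N i j
    · obtain ⟨k, hk, e⟩ := h1 i j hi
      exact ⟨k, by omega, e⟩
    · exact ⟨0, by omega, by simp [h0 i j hi]⟩
  choose f hf1 hf2 using h2
  refine ⟨fun i j => ⟨f i j, hf1 i j⟩, ?_⟩
  funext i j
  by_cases hij : i < N + 1 ∧ j < N + 2
  · simp [hij, hf2 i j]
  · have : ¬ Idx N i j := by
      intro hh
      unfold Idx at hh
      omega
    simp only [dif_neg hij, h0 i j this]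

theorem entry_le_shape {N : ℕ} {z : ℕ → ℕ → ℚ} (h : Interlacing N z) {i j : ℕ}
    (hi : Idx N i j) : z i j ≤ z N j := by
  have key : ∀ d, i + d ≤ N → z i j ≤ z (i + d) j := by
    intro d
    induction d with
    | zero => intro _; exact le_rfl
    | succ d ih =>
      intro hd
      refine (ih (by omega)).trans (h.1 (i + d) j ?_ ?_)
      · unfold Idx at hi ⊢; omega
      · unfold Idx at hi ⊢; omega
  have := key (N - i) (by unfold Idx at hi; omega)
  rwa [Nat.add_sub_cancel' hi.2.1] at this

theorem finite_patterns (N : ℕ) {l : ℕ} (hl : (N + 1) / 2 = l) (lam : Fin l → ℚ)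
    (S : Set (ℕ → ℕ → ℚ))
    (h : ∀ z ∈ S, IsArray N z ∧ (∀ i j, Idx N i j → IsHalfNat (z i j)) ∧ Interlacing N z ∧
      HasShape N lam z) : S.Finite := by
  obtain ⟨K, hK⟩ : ∃ K : ℕ, ∀ j, 2 * lam j < K := by
    obtain ⟨K, hK⟩ := exists_nat_gt (∑ j, |2 * lam j|)
    refine ⟨K, fun j => lt_of_le_of_lt ((le_abs_self _).trans ?_) hK⟩
    exact Finset.single_le_sum (f := fun j => |2 * lam j|) (fun _ _ => abs_nonneg _)
      (Finset.mem_univ j)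
  refine finite_of_bounded N K S fun z hz => ?_
  obtain ⟨h0, h1, h2, h3⟩ := h z hz
  refine ⟨h0, fun i j hij => ?_⟩
  obtain ⟨k, hk⟩ := h1 i j hij
  refine ⟨k, ?_, hk⟩
  have h4 := entry_le_shape h2 hij
  have hj : j - 1 < l := by unfold Idx at hij; omega
  have h5 := h3 ⟨j - 1, hj⟩
  have h6 : (j - 1) + 1 = j := by unfold Idx at hij; omega
  simp only [h6] at h5
  have h7 := hK ⟨j - 1, hj⟩
  have : (k : ℚ) < K := by linarith
  exact_mod_cast this

theorem IsNonnegInt.isHalfNat {q : ℚ} (h : IsNonnegInt q) : IsHalfNat q := by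
  obtain ⟨k, rfl⟩ := h
  exact ⟨2 * k, by push_cast; ring⟩

theorem IsNonnegHalfInt.isHalfNat {q : ℚ} (h : IsNonnegHalfInt q) : IsHalfNat q := by
  obtain ⟨k, rfl⟩ := h
  exact ⟨2 * k + 1, by push_cast; ring⟩

theorem spGT_finite (N : ℕ) {l : ℕ} (hl : (N + 1) / 2 = l) (lam : Fin l → ℚ) :
    (spGT N lam).Finite :=
  finite_patterns N hl lam _ fun _ hz =>
    ⟨hz.1, fun i j hij => (hz.2.1 i j hij).isHalfNat, hz.2.2.1, hz.2.2.2⟩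

theorem soGT_finite (n : ℕ) (lam : Fin n → ℚ) : (soGT n lam).Finite := by
  refine finite_patterns (2 * n) (by omega) lam _ fun z hz => ?_
  obtain ⟨h0, h1, h2, h3, h4⟩ := hz
  refine ⟨h0, fun i j hij => ?_, h3, h4⟩
  by_cases ho : IsOddEnd i j
  · exact h1 i j hij ho
  · rcases h2 with h2 | h2
    · exact (h2 i j hij ho).isHalfNat
    · exact (h2 i j hij ho).isHalfNat

theorem subPartitions_finite {n : ℕ} (mu : Fin n → ℚ) : (subPartitions mu).Finite := by
  obtain ⟨K, hK⟩ : ∃ K : ℕ, ∀ j, 2 * mu j < K := by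
    obtain ⟨K, hK⟩ := exists_nat_gt (∑ j, |2 * mu j|)
    refine ⟨K, fun j => lt_of_le_of_lt ((le_abs_self _).trans ?_) hK⟩
    exact Finset.single_le_sum (f := fun j => |2 * mu j|) (fun _ _ => abs_nonneg _)
      (Finset.mem_univ j)
  refine (Set.finite_range (fun (f : Fin n → Fin K) (i : Fin n) => ((f i : ℕ) : ℚ) / 2)).subset ?_
  rintro lam ⟨h1, h2⟩
  have h3 : ∀ i, IsHalfNat (lam i) := by
    rcases h1 with h | h
    · exact fun i => (h.2.2 i).isHalfNat
    · exact fun i => (h.2.2 i).isHalfNat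
  choose f hf using h3
  have h4 : ∀ i, f i < K := by
    intro i
    have a := h2 i
    have b := hK i
    have c := hf i
    have : (f i : ℚ) < K := by linarith
    exact_mod_cast this
  exact ⟨fun i => ⟨f i, h4 i⟩, by funext i; simp [hf i]⟩

/-! ### The polynomials

All polynomials live in the ring of finite `R`-linear combinations of formal monomials
`∏_v v^{q_v}`, with variables `v` ranging in `σ` and rational exponents `q_v`; this ring contains
the ring of Laurent polynomials in the variables `v^{1/2}`. -/

/-- Laurent polynomials over `R` in the variables `σ`, with rational exponents. -/
abbrev Poly (R σ : Type*) [CommRing R] := AddMonoidAlgebra R (σ →₀ ℚ)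

section

variable (R : Type*) [CommRing R] {σ : Type*}

/-- The monomial `v ^ q`. -/
def vpow (v : σ) (q : ℚ) : Poly R σ := AddMonoidAlgebra.single (Finsupp.single v q) 1

/-- The monomial `∏_{i=1}^n x_i^{type(z)_{2i} - type(z)_{2i-1}}`. -/
def weight {n : ℕ} (x : Fin n → σ) (z : ℕ → ℕ → ℚ) : Poly R σ :=
  ∏ i : Fin n, vpow R (x i) (rowType z (2 * (i + 1)) - rowType z (2 * (i + 1) - 1))

/-- The `CB`-interpolating Schur polynomial with parameter `β`, in the variables `x`. -/
def transCB {n : ℕ} (lam : Fin n → ℚ) (x : Fin n → σ) (β : R) : Poly R σ :=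
  ∑ᶠ z ∈ soGT n lam, β ^ atypCount n z • weight R x z

/-- The `(2n)`-symplectic Schur polynomial. -/
def spEven {n : ℕ} (lam : Fin n → ℚ) (x : Fin n → σ) : Poly R σ :=
  ∑ᶠ z ∈ spGT (2 * n) lam, weight R x z

/-- The `(2n+1)`-symplectic Schur polynomial. -/
def spOdd {n : ℕ} (lam : Fin (n + 1) → ℚ) (x : Fin n → σ) (y : σ) : Poly R σ :=
  ∑ᶠ z ∈ spGT (2 * n + 1) lam, weight R x z * vpow R y (rowType z (2 * n + 1))

/-- The `(2n+1)`-orthogonal Schur polynomial. -/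
def soOdd {n : ℕ} (lam : Fin n → ℚ) (x : Fin n → σ) : Poly R σ :=
  ∑ᶠ z ∈ soGT n lam, weight R x z

end

end CBSchur

end

namespace CBSchur

/-! ### Horizontal strips -/

/-! A pattern is a chain of rows in which consecutive rows differ by a horizontal strip, and two
successive rows together carry one variable `v` with exponent `|ν| - 2|κ| + |μ|`.

Cut a pattern with bottom row `u^{(n+m)}` at row `2n`. Interlacing freezes initial blocks of entries
`u` in the lower rows; once these are removed, every strip condition is reversed. The lower part
read upside down is therefore a pattern of some shape `λ`, the upper part has shape `(u^{(n-m)},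
λ)`, and the frozen entries cancel in the exponents (`rowKernel_preRow`, `sum_patternSum_flip`). The
lower variables come out in reversed order, so the identity needs the polynomials to be symmetric in
their variables (`patternSum_perm`).

Symmetry rests on commuting kernels. For fixed outer rows the entries of the middle row range over
independent intervals; reflecting each interval shows that strip kernels commute in the incidence
algebra (`stripKernel_commute`), hence so do the double strip kernels. In actual patterns row
lengths are bounded and odd ends carry a weight in `β`. Both effects are absorbed by writing a
truncated, weighted kernel as a combination of full kernels started at shifted rows, with
coefficients free of the variable (`doubleStripKernel_expansion_of_pos`,
`doubleStripKernel_expansion_of_zero`). Commutation of the full kernels then gives that of the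
truncated ones (`sum_doubleStripKernel_cb_comm`).

Half-integers are removed by rounding: each row becomes an integer row plus a common shift `h/2`,
and an odd end also remembers `e ∈ {0, 1}`, which is 1 exactly when it is atypical. The symplectic
case is `β = 0`, the orthogonal one `β = 1`. For the last identity, `s` is attached to the two
middle rows and the cut is made at the odd row between its two strips
(`patternSum_append_cons_rect`). -/

/-- `κ / μ` is a horizontal strip. -/
def HStrip (μ κ : ℕ →₀ ℕ) : Prop := ∀ j, κ (j + 1) ≤ μ j ∧ μ j ≤ κ j

/-- `μ` has at most `k` parts. -/
def LenLE (k : ℕ) (μ : ℕ →₀ ℕ) : Prop := ∀ j, k ≤ j → μ j = 0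

noncomputable instance (μ κ : ℕ →₀ ℕ) : Decidable (HStrip μ κ) := Classical.propDecidable _

noncomputable instance (k : ℕ) (μ : ℕ →₀ ℕ) : Decidable (LenLE k μ) := Classical.propDecidable _

theorem HStrip.le {μ κ : ℕ →₀ ℕ} (h : HStrip μ κ) : μ ≤ κ := fun j => (h j).2

theorem LenLE.of_le {μ ν : ℕ →₀ ℕ} {k : ℕ} (h : LenLE k ν) (hμ : μ ≤ ν) : LenLE k μ := by
  intro j hj
  have := hμ j
  rw [h j hj] at this
  omega

theorem LenLE.degree_eq {μ : ℕ →₀ ℕ} {k : ℕ} (h : LenLE k μ) :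
    μ.degree = ∑ j ∈ Finset.range k, μ j := by
  rw [Finsupp.degree_apply]
  refine Finset.sum_subset ?_ ?_
  · intro j hj
    by_contra hk
    exact Finsupp.mem_support_iff.1 hj (h j (by simpa using hk))
  · intro j _ hj
    simpa using hj

/-- The least value of `κ_j` for `κ` between `μ` and `ν` in the order of horizontal strips. -/
def loEntry (μ ν : ℕ →₀ ℕ) (j : ℕ) : ℕ := max (μ j) (ν (j + 1))

/-- The largest value of `κ_j` for `κ` between `μ` and `ν` in the order of horizontal strips. -/
def hiEntry (μ ν : ℕ →₀ ℕ) : ℕ → ℕ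
  | 0 => ν 0
  | j + 1 => min (ν (j + 1)) (μ j)

/-- For fixed outer rows the constraints on the middle row decouple into one interval per entry;
this is why two-strip sums factor. -/
theorem hStrip_and_hStrip_iff {μ κ ν : ℕ →₀ ℕ} :
    HStrip μ κ ∧ HStrip κ ν ↔ ∀ j, loEntry μ ν j ≤ κ j ∧ κ j ≤ hiEntry μ ν j := by
  constructor
  · rintro ⟨h1, h2⟩ j
    refine ⟨max_le (h1 j).2 (h2 j).1, ?_⟩
    cases j with
    | zero => exact (h2 0).2
    | succ j => exact le_min (h2 _).2 (h1 _).1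
  · intro h
    refine ⟨fun j => ⟨(h (j + 1)).2.trans (min_le_right _ _), (le_max_left _ _).trans (h j).1⟩,
      fun j => ⟨(le_max_right _ _).trans (h j).1, (h j).2.trans ?_⟩⟩
    cases j with
    | zero => exact le_rfl
    | succ j => exact min_le_left _ _

/-- The lower bound at `j` is a maximum and the upper bound at `j + 1` the minimum of the same two
numbers `μ j` and `ν (j + 1)`, so their sum is `μ j + ν (j + 1)`. -/
theorem sum_loEntry_add_hiEntry (μ ν : ℕ →₀ ℕ) (L : ℕ) (hν : LenLE L ν) :
    ∑ j ∈ Finset.range L, (loEntry μ ν j + hiEntry μ ν j) =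
      ∑ j ∈ Finset.range L, μ j + ∑ j ∈ Finset.range L, ν j := by
  -- The extra `min` is the still unpaired upper bound at `l`; it vanishes at `l = L` because `ν L =
  -- 0`.
  have key : ∀ l, ∑ j ∈ Finset.range l, (loEntry μ ν j + hiEntry μ ν j) + min (ν l) (if l = 0 then ν 0 else μ (l - 1)) =
      ∑ j ∈ Finset.range l, μ j + ∑ j ∈ Finset.range (l + 1), ν j := by
    intro l
    induction l with
    | zero => simp
    | succ l ih =>
      rw [Finset.sum_range_succ, Finset.sum_range_succ _ (l + 1), Finset.sum_range_succ (fun j => μ j)]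
      have h1 : hiEntry μ ν l = min (ν l) (if l = 0 then ν 0 else μ (l - 1)) := by
        cases l <;> simp [hiEntry]
      have h2 : loEntry μ ν l + min (ν (l + 1)) (μ l) = μ l + ν (l + 1) := by
        unfold loEntry; omega
      simp only [Nat.add_eq_zero_iff, one_ne_zero, and_false, if_false, Nat.add_sub_cancel]
      omega
  have := key L
  rw [Finset.sum_range_succ (fun j => ν j), hν L le_rfl] at this
  simpa using this

/-! ### Strip kernels in the incidence algebra and their commutation. -/

section

variable {A : Type*} [CommRing A]

theorem sum_between_eq_prod (L : ℕ) {μ ν : ℕ →₀ ℕ} (hμ : LenLE L μ) (hν : LenLE L ν) (t : A) :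
    ∑ κ ∈ (Finset.Icc μ ν).filter (fun κ => HStrip μ κ ∧ HStrip κ ν), t ^ κ.degree =
      ∏ j ∈ Finset.range L, ∑ c ∈ Finset.Icc (loEntry μ ν j) (hiEntry μ ν j), t ^ c := by
  rw [Finset.prod_range (fun j => ∑ c ∈ Finset.Icc (loEntry μ ν j) (hiEntry μ ν j), t ^ c),
    Finset.prod_univ_sum]
  refine Finset.sum_bij' (fun κ _ => fun j : Fin L => κ j)
    (fun f _ => Finsupp.onFinset (Finset.range L) (fun j => if h : j < L then f ⟨j, h⟩ else 0) ?_)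
    ?_ ?_ ?_ ?_ ?_
  · intro j hj
    by_contra h
    simp only [Finset.mem_range] at h
    simp [h] at hj
  · intro κ hκ
    simp only [Finset.mem_filter, hStrip_and_hStrip_iff] at hκ
    simp only [Fintype.mem_piFinset, Finset.mem_Icc]
    exact fun j => hκ.2 j
  · intro f hf
    simp only [Fintype.mem_piFinset, Finset.mem_Icc] at hf
    simp only [Finset.mem_filter]
    have : ∀ κ, HStrip μ κ ∧ HStrip κ ν → κ ∈ Finset.Icc μ ν ∧ HStrip μ κ ∧ HStrip κ ν :=
      fun κ h => ⟨Finset.mem_Icc.2 ⟨h.1.le, h.2.le⟩, h⟩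
    apply this
    rw [hStrip_and_hStrip_iff]
    intro j
    simp only [Finsupp.onFinset_apply]
    split_ifs with h
    · exact hf ⟨j, h⟩
    · simp [loEntry, hμ j (by omega), hν (j + 1) (by omega)]
  · intro κ hκ
    simp only [Finset.mem_filter, Finset.mem_Icc] at hκ
    ext j
    simp only [Finsupp.onFinset_apply]
    split_ifs with h
    · rfl
    · exact (hν.of_le hκ.1.2 j (by omega)).symm
  · intro f hf
    ext j
    simp
  · intro κ hκ
    simp only [Finset.mem_filter, Finset.mem_Icc] at hκ
    rw [(hν.of_le hκ.1.2).degree_eq, Finset.prod_pow_eq_pow_sum, Finset.sum_range]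

/-- The kernel adding a horizontal strip, the size of which is counted by `u`. -/
noncomputable def stripKernel (u : Aˣ) : IncidenceAlgebra A (ℕ →₀ ℕ) where
  toFun μ κ := if HStrip μ κ then ((u ^ ((κ.degree : ℤ) - μ.degree) : Aˣ) : A) else 0
  eq_zero_of_not_le' _ _ h := if_neg fun hs => h hs.le

theorem stripKernel_apply (u : Aˣ) (μ κ : ℕ →₀ ℕ) : stripKernel u μ κ =
    if HStrip μ κ then ((u ^ ((κ.degree : ℤ) - μ.degree) : Aˣ) : A) else 0 := rfl

theorem stripKernel_mul_apply (u v : Aˣ) (L : ℕ) {μ ν : ℕ →₀ ℕ} (hμ : LenLE L μ)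
    (hν : LenLE L ν) : (stripKernel u * stripKernel v) μ ν =
      ((u ^ (-(μ.degree : ℤ)) * v ^ (ν.degree : ℤ) : Aˣ) : A) *
        ∏ j ∈ Finset.range L, ∑ c ∈ Finset.Icc (loEntry μ ν j) (hiEntry μ ν j),
          ((u * v⁻¹ : Aˣ) : A) ^ c := by
  rw [← sum_between_eq_prod L hμ hν, IncidenceAlgebra.mul_apply, Finset.sum_filter, Finset.mul_sum]
  refine Finset.sum_congr rfl fun κ _ => ?_
  by_cases h1 : HStrip μ κ <;> by_cases h2 : HStrip κ ν <;>
    simp only [stripKernel_apply, h1, h2, if_true, if_false, and_true, and_false, and_self,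
      mul_zero, zero_mul]
  rw [← Units.val_mul, ← Units.val_pow_eq_pow_val, ← Units.val_mul]
  congr 1
  rw [mul_pow, zpow_sub, zpow_sub, zpow_neg, inv_pow]
  simp only [zpow_natCast]
  simp only [mul_assoc, mul_left_comm, mul_comm]

/-- Substitute `c ↦ a + b - c`. The identity also covers empty intervals, so no compatibility
between the outer rows is needed later. -/
theorem sum_Icc_pow_reflect (t : Aˣ) (a b : ℕ) :
    ∑ c ∈ Finset.Icc a b, (t : A) ^ c =
      (t : A) ^ (a + b) * ∑ c ∈ Finset.Icc a b, ((t⁻¹ : Aˣ) : A) ^ c := by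
  rw [Finset.mul_sum]
  refine Finset.sum_bij' (fun c _ => a + b - c) (fun c _ => a + b - c) ?_ ?_ ?_ ?_ ?_
  · intro c hc; simp only [Finset.mem_Icc] at hc ⊢; omega
  · intro c hc; simp only [Finset.mem_Icc] at hc ⊢; omega
  · intro c hc; simp only [Finset.mem_Icc] at hc ⊢; omega
  · intro c hc; simp only [Finset.mem_Icc] at hc ⊢; omega
  · intro c hc
    simp only [Finset.mem_Icc] at hc
    simp only [← Units.val_pow_eq_pow_val, ← Units.val_mul]
    congr 1
    obtain ⟨d, hd⟩ : ∃ d, a + b = c + d := ⟨a + b - c, by omega⟩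
    rw [hd, Nat.add_sub_cancel_left, pow_add, inv_pow, mul_assoc, mul_inv_cancel, mul_one]

/-- A Bender–Knuth argument: reflecting every entry of the middle row in its interval replaces `u/v`
by `v/u` and produces the factor `(u/v)^{|μ|+|ν|}`, which turns `u^{-|μ|} v^{|ν|}` into `v^{-|μ|}
u^{|ν|}`. -/
theorem stripKernel_commute (u v : Aˣ) : Commute (stripKernel u) (stripKernel v) := by
  refine IncidenceAlgebra.ext fun μ ν hle => ?_
  obtain ⟨L, hν⟩ : ∃ L, LenLE L ν := by
    refine ⟨ν.support.sup id + 1, fun j hj => ?_⟩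
    by_contra h
    have := Finset.le_sup (f := id) (Finsupp.mem_support_iff.2 h)
    simp only [id] at this
    omega
  have hμ := hν.of_le hle
  rw [stripKernel_mul_apply u v L hμ hν, stripKernel_mul_apply v u L hμ hν]
  simp_rw [sum_Icc_pow_reflect (u * v⁻¹)]
  rw [Finset.prod_mul_distrib, Finset.prod_pow_eq_pow_sum, sum_loEntry_add_hiEntry μ ν L hν,
    ← hμ.degree_eq, ← hν.degree_eq, ← mul_assoc, ← Units.val_pow_eq_pow_val, ← Units.val_mul]
  congr 1
  · congr 1
    rw [mul_pow, pow_add, pow_add, zpow_neg, zpow_neg]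
    simp only [zpow_natCast, inv_pow]
    apply mul_left_cancel (a := u ^ μ.degree * v ^ μ.degree * v ^ ν.degree)
    have : ∀ a b c d : Aˣ, a * b * c * (a⁻¹ * c * (a * d * (b⁻¹ * c⁻¹))) = a * d * c := by
      intro a b c d
      calc _ = (a * a⁻¹) * (b * b⁻¹) * (c * c⁻¹) * (a * d * c) := by
            simp only [mul_assoc, mul_left_comm, mul_comm]
        _ = _ := by simp
    rw [this]
    have : ∀ a b c d : Aˣ, a * b * c * (b⁻¹ * d) = a * d * c := by
      intro a b c d
      calc _ = (b * b⁻¹) * (a * d * c) := by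
            simp only [mul_assoc, mul_left_comm, mul_comm]
        _ = _ := by simp
    rw [this]

/-- The kernel `∑_κ u^{|ν| - 2 |κ| + |μ|}`, where `κ / μ` and `ν / κ` are horizontal strips. -/
noncomputable def doubleStripKernel (u : Aˣ) : IncidenceAlgebra A (ℕ →₀ ℕ) :=
  stripKernel u⁻¹ * stripKernel u

/-- This allows either strip to come first, which is needed when a pattern is cut at an odd row. -/
theorem doubleStripKernel_inv (u : Aˣ) : doubleStripKernel u⁻¹ = doubleStripKernel u := by
  unfold doubleStripKernel
  rw [inv_inv]
  exact stripKernel_commute u u⁻¹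

theorem doubleStripKernel_commute (u v : Aˣ) :
    Commute (doubleStripKernel u) (doubleStripKernel v) :=
  ((stripKernel_commute _ _).mul_right (stripKernel_commute _ _)).mul_left
    ((stripKernel_commute _ _).mul_right (stripKernel_commute _ _))

theorem doubleStripKernel_eq_prod (u : Aˣ) (L : ℕ) {μ ν : ℕ →₀ ℕ} (hμ : LenLE L μ)
    (hν : LenLE L ν) : doubleStripKernel u μ ν = ((u ^ (μ.degree + ν.degree) : Aˣ) : A) *
        ∏ j ∈ Finset.range L, ∑ c ∈ Finset.Icc (loEntry μ ν j) (hiEntry μ ν j),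
          ((u⁻¹ : Aˣ) : A) ^ (2 * c) := by
  unfold doubleStripKernel
  rw [stripKernel_mul_apply _ _ L hμ hν]
  congr 1
  · rw [pow_add, zpow_neg, inv_zpow, inv_inv, zpow_natCast, zpow_natCast]
  · refine Finset.prod_congr rfl fun j _ => Finset.sum_congr rfl fun c _ => ?_
    rw [pow_mul, pow_two, Units.val_mul]

theorem doubleStripKernel_apply (u : Aˣ) (μ ν : ℕ →₀ ℕ) : doubleStripKernel u μ ν =
    ∑ κ ∈ Finset.Iic ν, if HStrip μ κ ∧ HStrip κ ν then
      ((u ^ ((ν.degree : ℤ) - 2 * κ.degree + μ.degree) : Aˣ) : A) else 0 := by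
  have key : ∀ κ, stripKernel u⁻¹ μ κ * stripKernel u κ ν = if HStrip μ κ ∧ HStrip κ ν then
      ((u ^ ((ν.degree : ℤ) - 2 * κ.degree + μ.degree) : Aˣ) : A) else 0 := by
    intro κ
    by_cases h1 : HStrip μ κ <;> by_cases h2 : HStrip κ ν <;>
      simp only [stripKernel_apply, h1, h2, if_true, if_false, mul_zero, zero_mul, and_true,
        and_false, and_self]
    rw [← Units.val_mul, inv_zpow, ← zpow_neg, ← zpow_add]
    congr 2
    ring
  unfold doubleStripKernel
  rw [IncidenceAlgebra.mul_apply]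
  simp_rw [key]
  apply Finset.sum_subset
  · exact fun κ hκ => Finset.mem_Iic.2 (Finset.mem_Icc.1 hκ).2
  · intro κ _ hκ
    exact if_neg fun h => hκ (Finset.mem_Icc.2 ⟨h.1.le, h.2.le⟩)

end

/-! ### Truncated kernels as combinations of full kernels. -/

section

variable {A : Type*} [CommRing A]

/-- The sum `∑_{a ≤ c ≤ b} u^{-2c}`. -/
noncomputable def stepSum (u : Aˣ) (a b : ℕ) : A :=
  ∑ c ∈ Finset.Icc a b, ((u⁻¹ : Aˣ) : A) ^ (2 * c)

theorem stepSum_self (u : Aˣ) (a : ℕ) : stepSum u a a = ((u⁻¹ : Aˣ) : A) ^ (2 * a) := by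
  simp [stepSum]

theorem stepSum_of_lt (u : Aˣ) {a b : ℕ} (h : b < a) : stepSum u a b = 0 := by
  simp [stepSum, h]

theorem stepSum_eq_add (u : Aˣ) {a b : ℕ} (h : a ≤ b) :
    stepSum u a b = ((u⁻¹ : Aˣ) : A) ^ (2 * a) + stepSum u (a + 1) b := by
  unfold stepSum
  rw [← Finset.insert_Icc_add_one_left_eq_Icc h, Finset.sum_insert (by simp)]

theorem LenLE.add_single {k : ℕ} {μ : ℕ →₀ ℕ} (h : LenLE k μ) (a : ℕ) :
    LenLE (k + 1) (μ + Finsupp.single k a) := by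
  intro j hj
  simp [h j (by omega), show k ≠ j by omega]

theorem hiEntry_congr {μ ν μ' ν' : ℕ →₀ ℕ} {j : ℕ} (hν : ν j = ν' j)
    (hμ : ∀ i < j, μ i = μ' i) : hiEntry μ ν j = hiEntry μ' ν' j := by
  cases j with
  | zero => exact hν
  | succ j => simp only [hiEntry, hν, hμ j (Nat.lt_succ_self j)]

/-- Only the last factors of the product formula see `a`, `b`, `r`. The common prefactor reduces
relations between kernels at shifted rows to identities of finite geometric sums. -/
theorem doubleStripKernel_two (u : Aˣ) {k : ℕ} {μ ρ : ℕ →₀ ℕ} (hμ : LenLE k μ)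
    (hρ : LenLE (k + 1) ρ) (a b r : ℕ) :
    doubleStripKernel u (μ + Finsupp.single k a + Finsupp.single (k + 1) b)
        (ρ + Finsupp.single (k + 1) r) =
      (u : A) ^ (μ.degree + ρ.degree) *
        (∏ j ∈ Finset.range k, stepSum u (loEntry μ ρ j) (hiEntry μ ρ j)) *
          ((u : A) ^ (a + b + r) * stepSum u (max a r) (hiEntry μ ρ k) * stepSum u b (min r a)) := by
  have h1 : LenLE (k + 2) (μ + Finsupp.single k a + Finsupp.single (k + 1) b) :=
    (hμ.add_single a).add_single b
  have h2 : LenLE (k + 2) (ρ + Finsupp.single (k + 1) r) := hρ.add_single r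
  rw [doubleStripKernel_eq_prod u (k + 2) h1 h2, Finset.prod_range_succ, Finset.prod_range_succ]
  have e1 : loEntry (μ + Finsupp.single k a + Finsupp.single (k + 1) b)
      (ρ + Finsupp.single (k + 1) r) k = max a r := by
    simp [loEntry, hμ k le_rfl, hρ (k + 1) le_rfl]
  have e2 : loEntry (μ + Finsupp.single k a + Finsupp.single (k + 1) b)
      (ρ + Finsupp.single (k + 1) r) (k + 1) = b := by
    simp [loEntry, hμ (k + 1) (by omega), hρ (k + 2) (by omega)]
  have e3 : hiEntry (μ + Finsupp.single k a + Finsupp.single (k + 1) b)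
      (ρ + Finsupp.single (k + 1) r) (k + 1) = min r a := by
    simp [hiEntry, hμ k le_rfl, hρ (k + 1) le_rfl]
  have e4 : ∀ j ≤ k, hiEntry (μ + Finsupp.single k a + Finsupp.single (k + 1) b)
      (ρ + Finsupp.single (k + 1) r) j = hiEntry μ ρ j := by
    intro j hj
    refine hiEntry_congr ?_ fun i hi => ?_
    · simp [show k + 1 ≠ j by omega]
    · simp [show k + 1 ≠ i by omega, show k ≠ i by omega]
  have e5 : ∀ j < k, loEntry (μ + Finsupp.single k a + Finsupp.single (k + 1) b)
      (ρ + Finsupp.single (k + 1) r) j = loEntry μ ρ j := by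
    intro j hj
    simp [loEntry, show k + 1 ≠ j by omega, show k ≠ j by omega]
  rw [e1, e2, e3, e4 k le_rfl, Finset.prod_congr rfl fun j hj => by
    rw [e4 j (Finset.mem_range.1 hj).le, e5 j (Finset.mem_range.1 hj)]]
  simp only [map_add, Finsupp.degree_single, Units.val_pow_eq_pow_val]
  unfold stepSum
  ring

theorem doubleStripKernel_three (u : Aˣ) {k : ℕ} {μ ρ : ℕ →₀ ℕ} (hμ : LenLE k μ)
    (hρ : LenLE (k + 1) ρ) (a b c s r : ℕ) :
    doubleStripKernel u
        (μ + Finsupp.single k a + Finsupp.single (k + 1) b + Finsupp.single (k + 2) c)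
        (ρ + Finsupp.single (k + 1) s + Finsupp.single (k + 2) r) =
      (u : A) ^ (μ.degree + ρ.degree) *
        (∏ j ∈ Finset.range k, stepSum u (loEntry μ ρ j) (hiEntry μ ρ j)) *
          ((u : A) ^ (a + b + c + s + r) * stepSum u (max a s) (hiEntry μ ρ k) *
            stepSum u (max b r) (min s a) * stepSum u c (min r b)) := by
  set μ' := μ + Finsupp.single k a + Finsupp.single (k + 1) b + Finsupp.single (k + 2) c with hμ'
  set ρ' := ρ + Finsupp.single (k + 1) s + Finsupp.single (k + 2) r with hρ'
  have h1 : LenLE (k + 3) μ' := ((hμ.add_single a).add_single b).add_single c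
  have h2 : LenLE (k + 3) ρ' := (hρ.add_single s).add_single r
  rw [doubleStripKernel_eq_prod u (k + 3) h1 h2, Finset.prod_range_succ, Finset.prod_range_succ,
    Finset.prod_range_succ]
  have m0 : ∀ j < k, μ' j = μ j := by
    intro j hj
    simp [hμ', show k + 1 ≠ j by omega, show k ≠ j by omega,
      show k + 2 ≠ j by omega]
  have m1 : μ' k = a := by simp [hμ', hμ k le_rfl]
  have m2 : μ' (k + 1) = b := by simp [hμ', hμ (k + 1) (by omega)]
  have m3 : μ' (k + 2) = c := by simp [hμ', hμ (k + 2) (by omega)]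
  have r0 : ∀ j ≤ k, ρ' j = ρ j := by
    intro j hj
    simp [hρ', show k + 1 ≠ j by omega, show k + 2 ≠ j by omega]
  have r1 : ρ' (k + 1) = s := by simp [hρ', hρ (k + 1) le_rfl]
  have r2 : ρ' (k + 2) = r := by simp [hρ', hρ (k + 2) (by omega)]
  have e4 : ∀ j ≤ k, hiEntry μ' ρ' j = hiEntry μ ρ j := fun j hj =>
    hiEntry_congr (r0 j hj) fun i hi => m0 i (by omega)
  have e5 : ∀ j < k, loEntry μ' ρ' j = loEntry μ ρ j := fun j hj => by
    simp [loEntry, m0 j hj, r0 (j + 1) hj]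
  have e1 : loEntry μ' ρ' k = max a s := by rw [loEntry, m1, r1]
  have e2 : loEntry μ' ρ' (k + 1) = max b r := by rw [loEntry, m2, r2]
  have e3 : loEntry μ' ρ' (k + 2) = c := by rw [loEntry, m3, h2 (k + 3) le_rfl]; simp
  have e6 : hiEntry μ' ρ' (k + 1) = min s a := by rw [hiEntry, m1, r1]
  have e7 : hiEntry μ' ρ' (k + 2) = min r b := by rw [hiEntry, m2, r2]
  rw [e1, e2, e3, e6, e7, e4 k le_rfl, Finset.prod_congr rfl fun j hj => by
    rw [e4 j (Finset.mem_range.1 hj).le, e5 j (Finset.mem_range.1 hj)]]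
  simp only [hμ', hρ', map_add, Finsupp.degree_single, Units.val_pow_eq_pow_val]
  unfold stepSum
  ring

/-- The point is that the coefficients on the right depend on `β` alone, not on `u` or on the end
row. Composing with a second kernel thus leaves fixed combinations of products of commuting kernels.
-/
theorem doubleStripKernel_expansion_of_pos (u : Aˣ) (β : A) {k : ℕ} {μ ρ : ℕ →₀ ℕ}
    (hμ : LenLE k μ) (hρ : LenLE (k + 1) ρ) (r : ℕ) (hr : r ≤ ρ k)
    (hk : ∀ i, k = i + 1 → 1 ≤ μ i) :
    (if r = 0 then 1 else if r = 1 then β else 0) * (doubleStripKernel u μ ρ +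
        β * doubleStripKernel u (μ + Finsupp.single k 1) ρ) =
      doubleStripKernel u μ (ρ + Finsupp.single (k + 1) r) -
        doubleStripKernel u (μ + Finsupp.single k 1 + Finsupp.single (k + 1) 1)
          (ρ + Finsupp.single (k + 1) r) +
      β * (doubleStripKernel u (μ + Finsupp.single k 1) (ρ + Finsupp.single (k + 1) r) -
        doubleStripKernel u (μ + Finsupp.single k 2 + Finsupp.single (k + 1) 1)
          (ρ + Finsupp.single (k + 1) r)) +
      β ^ 2 * (doubleStripKernel u (μ + Finsupp.single k 1 + Finsupp.single (k + 1) 1)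
          (ρ + Finsupp.single (k + 1) r) -
        doubleStripKernel u (μ + Finsupp.single k 2 + Finsupp.single (k + 1) 2)
          (ρ + Finsupp.single (k + 1) r)) := by
  have T := doubleStripKernel_two u hμ hρ
  have T00 : ∀ r, _ := fun r => T 0 0 r
  have T10 : ∀ r, _ := fun r => T 1 0 r
  have T000 := T 0 0 0
  have T100 := T 1 0 0
  simp only [Finsupp.single_zero, add_zero] at T00 T10 T000 T100
  rw [T00 r, T10 r, T000, T100, T 1 1 r, T 2 1 r, T 2 2 r]
  set X := (u : A) ^ (μ.degree + ρ.degree) *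
        (∏ j ∈ Finset.range k, stepSum u (loEntry μ ρ j) (hiEntry μ ρ j))
  set m := hiEntry μ ρ k with hm
  have huv : (u : A) * ((u⁻¹ : Aˣ) : A) = 1 := u.mul_inv
  obtain rfl | rfl | ⟨q, rfl⟩ : r = 0 ∨ r = 1 ∨ ∃ q, r = q + 2 := by
    rcases r with _ | _ | q
    · simp
    · simp
    · exact Or.inr (Or.inr ⟨q, rfl⟩)
  · simp [stepSum_self, stepSum_of_lt]
  -- The interval of the entry at `k` must reach 1, so that its sums from 0 and from 1 can both be
  -- reduced to the common tail from 2. For `k > 0` this is where `hk` enters.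
  · have hm1 : 1 ≤ m := by
      rw [hm]
      cases k with
      | zero => exact hr
      | succ i => exact le_min hr (hk i rfl)
    have s0 := stepSum_eq_add u (Nat.zero_le m)
    have s1 := stepSum_eq_add u hm1
    have s01 := stepSum_eq_add u (Nat.zero_le 1)
    simp only [zero_add, Nat.reduceAdd] at s0 s1 s01
    simp only [one_ne_zero, if_false, if_true, show max 0 1 = 1 from rfl, show max 1 1 = 1 from rfl,
      show max 2 1 = 2 from rfl, show max 0 0 = 0 from rfl, show max 1 0 = 1 from rfl,
      show min 1 0 = 0 from rfl, show min 1 1 = 1 from rfl, show min 1 2 = 1 from rfl,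
      show min 0 0 = 0 from rfl, show min 0 1 = 0 from rfl, s01, stepSum_self,
      stepSum_of_lt u (show 1 < 2 by norm_num), s0, s1]
    generalize ((u⁻¹ : Aˣ) : A) = w at *
    generalize (u : A) = t at *
    generalize stepSum u 2 m = s at *
    clear_value X
    clear T T00 T10 T000 T100 s0 s1 s01
    grind
  · simp only [show max 0 (q + 2) = q + 2 by omega, show max 1 (q + 2) = q + 2 by omega,
      show max 2 (q + 2) = q + 2 by omega, show min (q + 2) 0 = 0 by omega,
      show min (q + 2) 1 = 1 by omega, show min (q + 2) 2 = 2 by omega, stepSum_self,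
      stepSum_eq_add u (show 0 ≤ 1 by norm_num), stepSum_eq_add u (show 1 ≤ 2 by norm_num),
      zero_add, Nat.reduceAdd, Nat.add_eq_zero_iff, Nat.reduceEqDiff, if_false, and_false,
      OfNat.ofNat_ne_zero, zero_mul]
    generalize ((u⁻¹ : Aˣ) : A) = w at *
    generalize (u : A) = t at *
    generalize stepSum u (q + 2) m = s at *
    simp only [pow_add]
    generalize t ^ q = z at *
    clear_value X
    clear T T00 T10 T000 T100
    grind

/-- When the entry before the odd end is zero, the preceding expansion breaks down at `r = 1`. Here
`μ + single (k + 1) 1` is not weakly decreasing, so its kernel vanishes. For `r = 1` the last term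
reproduces the kernel from `μ` to `ρ`: raising three entries of the start row pins two middle
entries to 1, and the powers of `u` cancel. -/
theorem doubleStripKernel_expansion_of_zero (u : Aˣ) (β : A) {k : ℕ} {μ ρ : ℕ →₀ ℕ}
    (hμ : LenLE k μ) (hρ : LenLE (k + 2) ρ) (r : ℕ) (hr : r ≤ ρ (k + 1)) :
    (if r = 0 then 1 else if r = 1 then β else 0) * (doubleStripKernel u μ ρ +
        β * doubleStripKernel u (μ + Finsupp.single (k + 1) 1) ρ) =
      doubleStripKernel u μ (ρ + Finsupp.single (k + 2) r) +
        β * doubleStripKernel u (μ + Finsupp.single k 1 + Finsupp.single (k + 1) 1 +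
          Finsupp.single (k + 2) 1) (ρ + Finsupp.single (k + 2) r) := by
  obtain ⟨ρ, s, hρ', rfl⟩ : ∃ ρ' s, LenLE (k + 1) ρ' ∧ ρ = ρ' + Finsupp.single (k + 1) s := by
    refine ⟨ρ.erase (k + 1), ρ (k + 1), fun j hj => ?_, (Finsupp.erase_add_single _ _).symm⟩
    rw [Finsupp.erase_apply]
    split_ifs with h
    · rfl
    · exact hρ j (by omega)
  have T := doubleStripKernel_three u hμ hρ'
  have T1 : ∀ r, _ := fun r => T 0 0 0 s r
  have T2 := T 0 0 0 s 0
  have T3 := T 0 1 0 s 0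
  simp only [Finsupp.single_zero, add_zero] at T1 T2 T3
  rw [T1 r, T2, T3, T 1 1 1 s r]
  have hr : r ≤ s := by simpa [hρ' (k + 1) le_rfl] using hr
  set X := (u : A) ^ (μ.degree + ρ.degree) *
        (∏ j ∈ Finset.range k, stepSum u (loEntry μ ρ j) (hiEntry μ ρ j))
  set m := hiEntry μ ρ k with hm
  have huv : (u : A) * ((u⁻¹ : Aˣ) : A) = 1 := u.mul_inv
  obtain rfl | rfl | ⟨q, rfl⟩ : r = 0 ∨ r = 1 ∨ ∃ q, r = q + 2 := by
    rcases r with _ | _ | q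
    · simp
    · simp
    · exact Or.inr (Or.inr ⟨q, rfl⟩)
  · simp [stepSum_self, stepSum_of_lt]
  · simp only [one_ne_zero, if_false, if_true, show max 0 1 = 1 from rfl,
      show max 1 1 = 1 from rfl, show max 0 0 = 0 from rfl, show max 1 0 = 1 from rfl,
      show min s 0 = 0 by omega, show min s 1 = 1 by omega, show min 1 0 = 0 from rfl,
      show min 1 1 = 1 from rfl, show max 1 s = s by omega, show max 0 s = s by omega,
      show min 0 0 = 0 from rfl, show min 0 1 = 0 from rfl, stepSum_self,
      stepSum_of_lt u (show 0 < 1 by norm_num)]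
    generalize ((u⁻¹ : Aˣ) : A) = w at *
    generalize (u : A) = t at *
    generalize stepSum u s m = s' at *
    clear_value X
    clear T T1 T2 T3
    simp only [pow_add]
    generalize t ^ s = z at *
    grind
  · simp [stepSum_of_lt]

end

/-! ### Commutation of truncated, weighted row kernels. -/

section

variable {A : Type*} [CommRing A]

theorem antitone_of_doubleStripKernel_ne_zero {u : Aˣ} {ρ ν : ℕ →₀ ℕ}
    (h : doubleStripKernel u ρ ν ≠ 0) (j : ℕ) : ρ (j + 1) ≤ ρ j := by
  rw [doubleStripKernel_apply] at h
  obtain ⟨κ, -, hκ⟩ := Finset.exists_ne_zero_of_sum_ne_zero h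
  have := (ite_ne_right_iff.1 hκ).1.1
  exact (this (j + 1)).2.trans (this j).1

theorem doubleStripKernel_mul_apply (u v : Aˣ) (μ ν : ℕ →₀ ℕ) :
    (doubleStripKernel u * doubleStripKernel v) μ ν =
      ∑ ρ ∈ Finset.Iic ν, doubleStripKernel u μ ρ * doubleStripKernel v ρ ν := by
  rw [IncidenceAlgebra.mul_apply]
  apply Finset.sum_subset
  · exact fun κ hκ => Finset.mem_Iic.2 (Finset.mem_Icc.1 hκ).2
  · intro κ hν hκ
    rw [IncidenceAlgebra.apply_eq_zero_of_not_le, zero_mul]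
    exact fun h => hκ (Finset.mem_Icc.2 ⟨h, Finset.mem_Iic.1 hν⟩)

theorem LenLE.erase {k : ℕ} {ρ : ℕ →₀ ℕ} (h : LenLE (k + 1) ρ) : LenLE k (ρ.erase k) := by
  intro j hj
  rw [Finsupp.erase_apply]
  split_ifs with hjk
  · rfl
  · exact h j (by omega)

/-- Rewriting a sum over rows `ρ` with at most `k` parts as a sum over all rows below `ν`. -/
theorem sum_lenLE_eq_sum_erase {k : ℕ} {ν : ℕ →₀ ℕ} (hν : LenLE (k + 1) ν)
    (F G : (ℕ →₀ ℕ) → A) (β : A) (hG : ∀ ρ, ¬ ρ ≤ ν → G ρ = 0) :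
    ∑ ρ ∈ (Finset.Iic ν).filter (LenLE k), F ρ * (G ρ + β * G (ρ + Finsupp.single k 1)) =
      ∑ ρ ∈ Finset.Iic ν, (if ρ k = 0 then 1 else if ρ k = 1 then β else 0) *
        F (ρ.erase k) * G ρ := by
  have h1 : ∑ ρ ∈ Finset.Iic ν, (if ρ k = 0 then 1 else if ρ k = 1 then β else 0) *
        F (ρ.erase k) * G ρ = ∑ ρ ∈ (Finset.Iic ν).filter (fun ρ => ρ k = 0), F ρ * G ρ +
        ∑ ρ ∈ (Finset.Iic ν).filter (fun ρ => ρ k = 1), β * (F (ρ.erase k) * G ρ) := by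
    rw [Finset.sum_filter, Finset.sum_filter, ← Finset.sum_add_distrib]
    refine Finset.sum_congr rfl fun ρ _ => ?_
    by_cases h0 : ρ k = 0
    · simp [h0]
    · by_cases h1 : ρ k = 1
      · simp [h1, mul_assoc]
      · simp [h0, h1]
  have h2 : (Finset.Iic ν).filter (LenLE k) = (Finset.Iic ν).filter (fun ρ => ρ k = 0) := by
    refine Finset.filter_congr fun ρ hρ => ⟨fun h => h k le_rfl, fun h j hj => ?_⟩
    obtain rfl | hj := hj.eq_or_lt
    · exact h
    · exact hν.of_le (Finset.mem_Iic.1 hρ) j hj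
  rw [h1, h2]
  simp_rw [mul_add]
  rw [Finset.sum_add_distrib]
  congr 1
  -- Rows that leave the region below `ν` when 1 is added at `k` contribute nothing by `hG`. On the
  -- others, adding and erasing this 1 are inverse to each other.
  rw [← Finset.sum_filter_add_sum_filter_not (Finset.filter (fun ρ => ρ k = 0) (Finset.Iic ν))
    (fun ρ => ρ + Finsupp.single k 1 ≤ ν), Finset.sum_eq_zero (s := Finset.filter (fun ρ => ¬ _) _),
    add_zero]
  · refine Finset.sum_bij' (fun ρ _ => ρ + Finsupp.single k 1) (fun ρ _ => ρ.erase k)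
      ?_ ?_ ?_ ?_ ?_
    · intro ρ hρ
      simp only [Finset.mem_filter, Finset.mem_Iic] at hρ ⊢
      exact ⟨hρ.2, by simp [hρ.1.2]⟩
    · intro ρ hρ
      simp only [Finset.mem_filter, Finset.mem_Iic] at hρ ⊢
      have := Finsupp.erase_add_single k ρ
      rw [hρ.2] at this
      refine ⟨⟨le_trans ?_ hρ.1, by simp⟩, this.trans_le hρ.1⟩
      conv_rhs => rw [← this]
      exact le_self_add
    · intro ρ hρ
      simp only [Finset.mem_filter, Finset.mem_Iic] at hρ ⊢
      ext j
      by_cases hj : j = k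
      · subst hj; simp [hρ.1.2]
      · simp [hj]
    · intro ρ hρ
      simp only [Finset.mem_filter, Finset.mem_Iic] at hρ ⊢
      have := Finsupp.erase_add_single k ρ
      rwa [hρ.2] at this
    · intro ρ hρ
      simp only [Finset.mem_filter, Finset.mem_Iic] at hρ ⊢
      have : (ρ + Finsupp.single k 1).erase k = ρ := by
        ext j
        by_cases hj : j = k
        · subst hj; simp [hρ.1.2]
        · simp [hj]
      rw [this]
      ring
  · intro ρ hρ
    simp only [Finset.mem_filter] at hρ
    rw [hG _ hρ.2, mul_zero, mul_zero]

/-- Bounding the length of the intermediate row destroys the product structure. The expansions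
restore it: each side becomes the same combination of entries of a product of two full kernels, and
these commute. -/
theorem sum_doubleStripKernel_cb_comm (u v : Aˣ) (β : A) {k : ℕ} {μ ν : ℕ →₀ ℕ}
    (hμ : LenLE k μ) (hν : LenLE (k + 2) ν) :
    ∑ ρ ∈ (Finset.Iic ν).filter (LenLE (k + 1)),
      (doubleStripKernel u μ ρ + β * doubleStripKernel u (μ + Finsupp.single k 1) ρ) *
      (doubleStripKernel v ρ ν + β * doubleStripKernel v (ρ + Finsupp.single (k + 1) 1) ν) =
    ∑ ρ ∈ (Finset.Iic ν).filter (LenLE (k + 1)),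
      (doubleStripKernel v μ ρ + β * doubleStripKernel v (μ + Finsupp.single k 1) ρ) *
      (doubleStripKernel u ρ ν + β * doubleStripKernel u (ρ + Finsupp.single (k + 1) 1) ν) := by
  have hcomm : ∀ μ', (doubleStripKernel u * doubleStripKernel v) μ' ν =
      (doubleStripKernel v * doubleStripKernel u) μ' ν := fun μ' => by
    rw [(doubleStripKernel_commute u v).eq]
  have start : ∀ u v : Aˣ, ∑ ρ ∈ (Finset.Iic ν).filter (LenLE (k + 1)),
      (doubleStripKernel u μ ρ + β * doubleStripKernel u (μ + Finsupp.single k 1) ρ) *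
      (doubleStripKernel v ρ ν + β * doubleStripKernel v (ρ + Finsupp.single (k + 1) 1) ν) =
      ∑ ρ ∈ Finset.Iic ν, (if ρ (k + 1) = 0 then 1 else if ρ (k + 1) = 1 then β else 0) *
        (doubleStripKernel u μ (ρ.erase (k + 1)) +
          β * doubleStripKernel u (μ + Finsupp.single k 1) (ρ.erase (k + 1))) *
            doubleStripKernel v ρ ν := by
    intro u v
    exact sum_lenLE_eq_sum_erase hν
      (fun ρ => doubleStripKernel u μ ρ + β * doubleStripKernel u (μ + Finsupp.single k 1) ρ)
      (fun ρ => doubleStripKernel v ρ ν) β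
      (fun ρ h => IncidenceAlgebra.apply_eq_zero_of_not_le h _)
  rw [start, start]
  by_cases hk : ∀ i, k = i + 1 → 1 ≤ μ i
  · have main : ∀ u v : Aˣ,
        ∑ ρ ∈ Finset.Iic ν, (if ρ (k + 1) = 0 then 1 else if ρ (k + 1) = 1 then β else 0) *
          (doubleStripKernel u μ (ρ.erase (k + 1)) +
            β * doubleStripKernel u (μ + Finsupp.single k 1) (ρ.erase (k + 1))) *
              doubleStripKernel v ρ ν =
        (doubleStripKernel u * doubleStripKernel v) μ ν -
          (doubleStripKernel u * doubleStripKernel v)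
            (μ + Finsupp.single k 1 + Finsupp.single (k + 1) 1) ν +
        β * ((doubleStripKernel u * doubleStripKernel v) (μ + Finsupp.single k 1) ν -
          (doubleStripKernel u * doubleStripKernel v)
            (μ + Finsupp.single k 2 + Finsupp.single (k + 1) 1) ν) +
        β ^ 2 * ((doubleStripKernel u * doubleStripKernel v)
            (μ + Finsupp.single k 1 + Finsupp.single (k + 1) 1) ν -
          (doubleStripKernel u * doubleStripKernel v)
            (μ + Finsupp.single k 2 + Finsupp.single (k + 1) 2) ν) := by
      intro u v
      simp only [doubleStripKernel_mul_apply, ← Finset.sum_sub_distrib, Finset.mul_sum,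
        ← Finset.sum_add_distrib]
      refine Finset.sum_congr rfl fun ρ hρ => ?_
      -- A nonzero kernel forces `ρ` to be weakly decreasing, which is the bound on the last entry
      -- required by the expansion.
      by_cases hz : doubleStripKernel v ρ ν = 0
      · simp [hz]
      have hρ' : LenLE (k + 2) ρ := hν.of_le (Finset.mem_Iic.1 hρ)
      have := doubleStripKernel_expansion_of_pos u β hμ hρ'.erase (ρ (k + 1))
        (by simpa [Finsupp.erase_apply] using antitone_of_doubleStripKernel_ne_zero hz k) hk
      rw [Finsupp.erase_add_single] at this
      rw [this]
      ring
    rw [main, main]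
    simp only [hcomm]
  -- What remains is `k = i + 1` with `μ i = 0`, so `μ` has at most `i` parts.
  · push Not at hk
    obtain ⟨i, rfl, hi⟩ := hk
    have hμ' : LenLE i μ := by
      intro j hj
      obtain rfl | hj := hj.eq_or_lt
      · omega
      · exact hμ j hj
    have main : ∀ u v : Aˣ,
        ∑ ρ ∈ Finset.Iic ν, (if ρ (i + 1 + 1) = 0 then 1 else if ρ (i + 1 + 1) = 1 then β else 0) *
          (doubleStripKernel u μ (ρ.erase (i + 1 + 1)) +
            β * doubleStripKernel u (μ + Finsupp.single (i + 1) 1) (ρ.erase (i + 1 + 1))) *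
              doubleStripKernel v ρ ν =
        (doubleStripKernel u * doubleStripKernel v) μ ν +
          β * (doubleStripKernel u * doubleStripKernel v)
            (μ + Finsupp.single i 1 + Finsupp.single (i + 1) 1 + Finsupp.single (i + 2) 1) ν := by
      intro u v
      simp only [doubleStripKernel_mul_apply, Finset.mul_sum, ← Finset.sum_add_distrib]
      refine Finset.sum_congr rfl fun ρ hρ => ?_
      by_cases hz : doubleStripKernel v ρ ν = 0
      · simp [hz]
      have hρ' : LenLE (i + 3) ρ := hν.of_le (Finset.mem_Iic.1 hρ)
      have := doubleStripKernel_expansion_of_zero u β hμ' hρ'.erase (ρ (i + 2))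
        (by simpa [Finsupp.erase_apply] using antitone_of_doubleStripKernel_ne_zero hz (i + 1))
      rw [Finsupp.erase_add_single] at this
      rw [this]
      ring
    rw [main, main]
    simp only [hcomm]

/-- The kernel of two successive rows of a pattern, ending in rows of length `k` and `k + 1`;
the odd end `c` of the row between them has weight `g c`. -/
noncomputable def rowKernel (k : ℕ) (u : Aˣ) (g : ℕ → A) (μ ν : ℕ →₀ ℕ) : A :=
  ∑ κ ∈ Finset.Iic ν, if HStrip μ κ ∧ HStrip κ ν then
    ((u ^ ((ν.degree : ℤ) - 2 * κ.degree + μ.degree) : Aˣ) : A) * g (κ k) else 0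

/-- Starting from `μ + single k 1` forces `κ k ≥ 1` and multiplies the monomial by `u`: this is
precisely the additional weight `β u` of a nonzero odd end. -/
theorem rowKernel_cb (k : ℕ) (u : Aˣ) (β : A) {μ ν : ℕ →₀ ℕ} (hμ : LenLE k μ)
    (hν : LenLE (k + 1) ν) :
    rowKernel k u (fun c => if c = 0 then 1 else 1 + β * u) μ ν =
      doubleStripKernel u μ ν + β * doubleStripKernel u (μ + Finsupp.single k 1) ν := by
  rw [doubleStripKernel_apply, doubleStripKernel_apply, Finset.mul_sum, ← Finset.sum_add_distrib]
  refine Finset.sum_congr rfl fun κ hκ => ?_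
  have hκ' : LenLE (k + 1) κ := hν.of_le (Finset.mem_Iic.1 hκ)
  by_cases h2 : HStrip κ ν
  swap
  · simp [h2]
  have h : HStrip (μ + Finsupp.single k 1) κ ↔ HStrip μ κ ∧ κ k ≠ 0 := by
    constructor
    · intro h
      have h1 := (h k).2
      rw [Finsupp.add_apply, hμ k le_rfl, Finsupp.single_eq_same] at h1
      refine ⟨fun j => ?_, by omega⟩
      by_cases hj : j = k
      · subst hj
        rw [hκ' (j + 1) le_rfl, hμ j le_rfl]
        omega
      · simpa [Ne.symm hj] using h j
    · rintro ⟨h, hk⟩ j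
      by_cases hj : j = k
      · subst hj
        simp only [hκ' (j + 1) le_rfl, hμ j le_rfl, Finsupp.add_apply, Finsupp.single_eq_same]
        omega
      · simpa [Ne.symm hj] using h j
  by_cases h1 : HStrip μ κ
  swap
  · simp [h, h1]
  by_cases h0 : κ k = 0
  · simp [h, h0, h1]
  · simp only [h, h0, h1, h2, and_self, if_true, if_false, map_add, Finsupp.degree_single,
      not_false_eq_true, ne_eq]
    have : u ^ ((ν.degree : ℤ) - 2 * κ.degree + (μ.degree + 1 : ℕ)) =
        u ^ ((ν.degree : ℤ) - 2 * κ.degree + μ.degree) * u := by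
      rw [Nat.cast_add, Nat.cast_one, ← add_assoc, zpow_add_one]
    rw [this, Units.val_mul]
    ring

end

/-! ### Generating functions of patterns and their symmetry. -/

section

variable {A : Type*} [CommRing A] {σ : Type*}

theorem rowKernel_eq_zero_of_not_le {k : ℕ} {u : Aˣ} {g : ℕ → A} {μ ν : ℕ →₀ ℕ} (h : ¬ μ ≤ ν) :
    rowKernel k u g μ ν = 0 :=
  Finset.sum_eq_zero fun _ _ => if_neg fun hs => h (hs.1.le.trans hs.2.le)

theorem rowKernel_const (k : ℕ) (u : Aˣ) (c : A) (μ ν : ℕ →₀ ℕ) :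
    rowKernel k u (fun _ => c) μ ν = doubleStripKernel u μ ν * c := by
  rw [doubleStripKernel_apply, rowKernel, Finset.sum_mul]
  refine Finset.sum_congr rfl fun κ _ => ?_
  split_ifs <;> simp

/-- Two successive row kernels with weights `g` commute. -/
def RowKernelsCommute (U : σ → Aˣ) (g : σ → ℕ → A) : Prop :=
  ∀ (v w : σ) (k : ℕ) (μ ν : ℕ →₀ ℕ), LenLE k μ → LenLE (k + 2) ν →
    ∑ ρ ∈ (Finset.Iic ν).filter (LenLE (k + 1)),
      rowKernel k (U v) (g v) μ ρ * rowKernel (k + 1) (U w) (g w) ρ ν =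
    ∑ ρ ∈ (Finset.Iic ν).filter (LenLE (k + 1)),
      rowKernel k (U w) (g w) μ ρ * rowKernel (k + 1) (U v) (g v) ρ ν

theorem rowKernelsCommute_cb (U : σ → Aˣ) (β : A) :
    RowKernelsCommute U fun v c => if c = 0 then 1 else 1 + β * U v := by
  intro v w k μ ν hμ hν
  have key : ∀ v w, ∑ ρ ∈ (Finset.Iic ν).filter (LenLE (k + 1)),
      rowKernel k (U v) (fun c => if c = 0 then 1 else 1 + β * U v) μ ρ *
        rowKernel (k + 1) (U w) (fun c => if c = 0 then 1 else 1 + β * U w) ρ ν = _ := fun v w =>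
    Finset.sum_congr rfl fun ρ hρ => by
      rw [rowKernel_cb k (U v) β hμ (Finset.mem_filter.1 hρ).2,
        rowKernel_cb (k + 1) (U w) β (Finset.mem_filter.1 hρ).2 hν]
  rw [key, key, sum_doubleStripKernel_cb_comm _ _ β hμ hν]

/-- A weight that ignores the odd end only rescales the kernel, so the case `β = 0` applies. -/
theorem rowKernelsCommute_const (U : σ → Aˣ) (c : σ → A) :
    RowKernelsCommute U fun v _ => c v := by
  intro v w k μ ν hμ hν
  have := sum_doubleStripKernel_cb_comm (U v) (U w) 0 hμ hν
  simp only [zero_mul, add_zero] at this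
  simp only [rowKernel_const]
  calc _ = (∑ ρ ∈ (Finset.Iic ν).filter (LenLE (k + 1)),
        doubleStripKernel (U v) μ ρ * doubleStripKernel (U w) ρ ν) * (c v * c w) := by
        rw [Finset.sum_mul]
        exact Finset.sum_congr rfl fun _ _ => by ring
    _ = _ := by
        rw [this, Finset.sum_mul]
        exact Finset.sum_congr rfl fun _ _ => by ring

/-- The generating function of patterns with an even number of rows, the last of which is the
argument; the head of the list is the variable of the last two rows. -/
noncomputable def patternSum (U : σ → Aˣ) (g : σ → ℕ → A) : List σ → (ℕ →₀ ℕ) → A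
  | [], _ => 1
  | v :: l, ν => ∑ μ ∈ (Finset.Iic ν).filter (LenLE l.length),
      patternSum U g l μ * rowKernel l.length (U v) (g v) μ ν

theorem patternSum_cons (U : σ → Aˣ) (g : σ → ℕ → A) (v : σ) (l : List σ) (ν : ℕ →₀ ℕ) :
    patternSum U g (v :: l) ν = ∑ μ ∈ (Finset.Iic ν).filter (LenLE l.length),
      patternSum U g l μ * rowKernel l.length (U v) (g v) μ ν := rfl

theorem patternSum_cons_cons (U : σ → Aˣ) (g : σ → ℕ → A) (v w : σ) (l : List σ) (ν : ℕ →₀ ℕ) :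
    patternSum U g (v :: w :: l) ν = ∑ μ ∈ (Finset.Iic ν).filter (LenLE l.length),
      patternSum U g l μ * ∑ ρ ∈ (Finset.Iic ν).filter (LenLE (l.length + 1)),
        rowKernel l.length (U w) (g w) μ ρ * rowKernel (l.length + 1) (U v) (g v) ρ ν := by
  rw [patternSum_cons]
  simp_rw [patternSum_cons, Finset.mul_sum]
  rw [Finset.sum_comm]
  refine Finset.sum_congr rfl fun ρ hρ => ?_
  rw [Finset.sum_mul]
  simp_rw [List.length_cons, ← mul_assoc]
  have hρν := Finset.mem_Iic.1 (Finset.mem_filter.1 hρ).1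
  apply Finset.sum_subset
  · intro μ hμ
    simp only [Finset.mem_filter, Finset.mem_Iic] at hμ ⊢
    exact ⟨hμ.1.trans hρν, hμ.2⟩
  · intro μ hμ hμ'
    simp only [Finset.mem_filter, Finset.mem_Iic] at hμ hμ'
    rw [rowKernel_eq_zero_of_not_le fun h => hμ' ⟨h, hμ.2⟩]
    simp

/-- Exchanging two adjacent variables exchanges two consecutive row kernels with the rows around
them held fixed. -/
theorem patternSum_perm {U : σ → Aˣ} {g : σ → ℕ → A} (hc : RowKernelsCommute U g)
    {l l' : List σ} (h : l.Perm l') {ν : ℕ →₀ ℕ} (hν : LenLE l.length ν) :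
    patternSum U g l ν = patternSum U g l' ν := by
  induction h generalizing ν with
  | nil => rfl
  | cons v h ih =>
    rw [patternSum_cons, patternSum_cons, h.length_eq]
    refine Finset.sum_congr rfl fun μ hμ => ?_
    rw [ih (by rw [h.length_eq]; exact (Finset.mem_filter.1 hμ).2)]
  | swap v w l =>
    rw [patternSum_cons_cons, patternSum_cons_cons]
    refine Finset.sum_congr rfl fun μ hμ => ?_
    rw [hc v w l.length μ ν (Finset.mem_filter.1 hμ).2 hν]
  | trans h1 h2 ih1 ih2 =>
    rw [ih1 hν, ih2 (by rwa [← h1.length_eq])]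

/-! ### Rows beginning with a constant block -/

/-- The row `(u^{(q)}, λ)`. -/
noncomputable def preRow (q u : ℕ) (lam : ℕ →₀ ℕ) : ℕ →₀ ℕ :=
  Finsupp.onFinset (Finset.range q ∪ lam.support.image (· + q))
    (fun i => if i < q then u else lam (i - q)) (by
      intro i hi
      simp only [Finset.mem_union, Finset.mem_range, Finset.mem_image, Finsupp.mem_support_iff]
      by_cases h : i < q
      · exact Or.inl h
      · rw [if_neg h] at hi
        exact Or.inr ⟨i - q, hi, by omega⟩)

theorem preRow_apply (q u : ℕ) (lam : ℕ →₀ ℕ) (i : ℕ) :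
    preRow q u lam i = if i < q then u else lam (i - q) := rfl

/-- The row without its first `q` entries. -/
noncomputable def dropRow (q : ℕ) (lam : ℕ →₀ ℕ) : ℕ →₀ ℕ :=
  Finsupp.comapDomain (· + q) lam (add_left_injective q).injOn

theorem dropRow_apply (q : ℕ) (lam : ℕ →₀ ℕ) (i : ℕ) : dropRow q lam i = lam (i + q) := rfl

theorem dropRow_preRow (q u : ℕ) (lam : ℕ →₀ ℕ) : dropRow q (preRow q u lam) = lam := by
  ext i
  simp [dropRow_apply, preRow_apply]

theorem preRow_injective (q u : ℕ) : Function.Injective (preRow q u) :=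
  Function.LeftInverse.injective (dropRow_preRow q u)

theorem preRow_dropRow {q u : ℕ} {lam : ℕ →₀ ℕ} (h : ∀ i < q, lam i = u) :
    preRow q u (dropRow q lam) = lam := by
  ext i
  rw [preRow_apply]
  split_ifs with hi
  · exact (h i hi).symm
  · rw [dropRow_apply]
    congr 1
    omega

theorem LenLE.preRow {p : ℕ} {lam : ℕ →₀ ℕ} (h : LenLE p lam) (q u : ℕ) :
    LenLE (q + p) (preRow q u lam) := by
  intro j hj
  rw [preRow_apply, if_neg (by omega), h _ (by omega)]

theorem LenLE.degree_preRow {p : ℕ} {lam : ℕ →₀ ℕ} (h : LenLE p lam) (q u : ℕ) :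
    (CBSchur.preRow q u lam).degree = q * u + lam.degree := by
  rw [(h.preRow q u).degree_eq, Finset.sum_range_add, h.degree_eq]
  congr 1
  · rw [Finset.sum_congr rfl fun i hi => by
      rw [preRow_apply, if_pos (Finset.mem_range.1 hi)]]
    simp
  · exact Finset.sum_congr rfl fun i _ => by simp [preRow_apply]

/-- The rows with at most `p` parts, all of them at most `u`. -/
noncomputable def rowBox (p u : ℕ) : Finset (ℕ →₀ ℕ) := Finset.Iic (preRow p u 0)

theorem mem_rowBox {p u : ℕ} {lam : ℕ →₀ ℕ} :
    lam ∈ rowBox p u ↔ LenLE p lam ∧ ∀ i, lam i ≤ u := by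
  rw [rowBox, Finset.mem_Iic]
  constructor
  · intro h
    refine ⟨fun j hj => ?_, fun i => ?_⟩
    · have := h j
      rw [preRow_apply, if_neg (by omega)] at this
      simpa using this
    · refine (h i).trans ?_
      rw [preRow_apply]
      split_ifs <;> simp
  · rintro ⟨h1, h2⟩ i
    rw [preRow_apply]
    split_ifs with h
    · exact h2 i
    · rw [h1 i (by omega)]; simp

/-- The duality behind the decomposition: the lower row has one more frozen entry, so removing the
blocks shifts its indices by one relative to the upper row and interchanges the two interlacing
inequalities. -/
theorem hStrip_preRow {q u : ℕ} {κ lam : ℕ →₀ ℕ} (hκ : ∀ i, κ i ≤ u) :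
    HStrip (preRow q u κ) (preRow (q + 1) u lam) ↔ HStrip lam κ := by
  constructor
  · intro h j
    have h1 := (h (j + q)).1
    have h2 := (h (j + q + 1)).2
    simp only [preRow_apply] at h1 h2
    rw [if_neg (by omega), if_neg (by omega)] at h1 h2
    rw [show j + q + 1 - (q + 1) = j by omega] at h1 h2
    rw [show j + q - q = j by omega] at h1
    rw [show j + q + 1 - q = j + 1 by omega] at h2
    exact ⟨h2, h1⟩
  · intro h j
    simp only [preRow_apply]
    rcases lt_trichotomy j q with hj | rfl | hj
    · simp [hj, show j < q + 1 by omega]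
    · have := (h 0).2
      simp [hκ, this]
    · obtain ⟨i, rfl⟩ : ∃ i, j = q + 1 + i := ⟨j - (q + 1), by omega⟩
      rw [if_neg (by omega), if_neg (by omega), if_neg (by omega)]
      rw [show q + 1 + i + 1 - (q + 1) = i + 1 by omega, show q + 1 + i - q = i + 1 by omega,
        show q + 1 + i - (q + 1) = i by omega]
      exact ⟨(h (i + 1)).2, (h i).1⟩

/-- A row above `(u^{(q + 1)}, λ)` begins with `u^{(q)}`. -/
theorem exists_eq_preRow_of_hStrip {q p u : ℕ} {κ lam : ℕ →₀ ℕ} (hlam : lam ∈ rowBox p u)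
    (h : HStrip κ (preRow (q + 1) u lam)) (hκ : LenLE (q + p + 1) κ) :
    ∃ κ' ∈ rowBox (p + 1) u, κ = preRow q u κ' := by
  have hle : ∀ i, κ i ≤ u := by
    intro i
    refine (h i).2.trans ?_
    rw [preRow_apply]
    split_ifs
    · exact le_rfl
    · exact (mem_rowBox.1 hlam).2 _
  refine ⟨dropRow q κ, ?_, (preRow_dropRow fun i hi => ?_).symm⟩
  · exact mem_rowBox.2 ⟨fun j hj => by rw [dropRow_apply, hκ _ (by omega)], fun i => hle _⟩
  · refine le_antisymm (hle i) ?_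
    have := (h i).1
    rwa [preRow_apply, if_pos (by omega)] at this

/-- Duality is applied to both strips. The blocks contribute `(q + 2)u - 2(q + 1)u + qu = 0` to the
exponent, and the odd end at position `q + p + 1` is the entry at `p` after the block of length `q +
1` is removed, so its weight is unchanged. -/
theorem rowKernel_preRow {q p u : ℕ} (v : Aˣ) (g : ℕ → A) {lam lam' : ℕ →₀ ℕ}
    (hlam : lam ∈ rowBox p u) (hlam' : lam' ∈ rowBox (p + 1) u) :
    rowKernel (q + p + 1) v g (preRow q u lam') (preRow (q + 2) u lam) =
      rowKernel p v g lam lam' := by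
  unfold rowKernel
  rw [← Finset.sum_filter, ← Finset.sum_filter]
  symm
  have hle : ∀ κ, HStrip κ lam' → ∀ i, κ i ≤ u := fun κ h i =>
    (h.le i).trans ((mem_rowBox.1 hlam').2 i)
  have hlen : ∀ κ, HStrip κ lam' → LenLE (p + 1) κ := fun κ h =>
    (mem_rowBox.1 hlam').1.of_le h.le
  have hlen2 := (mem_rowBox.1 hlam).1.preRow (q + 2) u
  refine Finset.sum_bij (fun κ _ => preRow (q + 1) u κ) ?_ ?_ ?_ ?_
  · intro κ hκ
    simp only [Finset.mem_filter, Finset.mem_Iic] at hκ ⊢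
    have h1 := (hStrip_preRow (q := q + 1) (hle κ hκ.2.2)).2 hκ.2.1
    exact ⟨h1.le, (hStrip_preRow (mem_rowBox.1 hlam').2).2 hκ.2.2, h1⟩
  · exact fun κ _ κ' _ h => preRow_injective _ _ h
  · intro κ hκ
    simp only [Finset.mem_filter, Finset.mem_Iic] at hκ
    obtain ⟨κ', h1, rfl⟩ := exists_eq_preRow_of_hStrip (q := q + 1) hlam hκ.2.2
      (fun j hj => hlen2.of_le hκ.1 j (by omega))
    rw [hStrip_preRow (mem_rowBox.1 h1).2, hStrip_preRow (mem_rowBox.1 hlam').2] at hκ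
    exact ⟨κ', Finset.mem_filter.2 ⟨Finset.mem_Iic.2 hκ.2.1.le, hκ.2.2, hκ.2.1⟩, rfl⟩
  · intro κ hκ
    simp only [Finset.mem_filter, Finset.mem_Iic] at hκ
    rw [(mem_rowBox.1 hlam).1.degree_preRow, (mem_rowBox.1 hlam').1.degree_preRow,
      (hlen κ hκ.2.2).degree_preRow, preRow_apply, if_neg (by omega),
      show q + p + 1 - (q + 1) = p by omega]
    congr 3
    push_cast
    ring

/-- The last two rows of the left pattern, turned upside down, become the last two rows of the right
pattern. -/
theorem sum_patternSum_flip (U : σ → Aˣ) (g : σ → ℕ → A) (u q : ℕ) (v : σ) (l r : List σ)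
    (hl : l.length = q + r.length + 1) :
    ∑ lam ∈ rowBox r.length u,
      patternSum U g (v :: l) (preRow (q + 2) u lam) * patternSum U g r lam =
    ∑ lam ∈ rowBox (r.length + 1) u,
      patternSum U g l (preRow q u lam) * patternSum U g (v :: r) lam := by
  have h1 : ∀ lam ∈ rowBox r.length u, patternSum U g (v :: l) (preRow (q + 2) u lam) =
      ∑ lam' ∈ rowBox (r.length + 1) u, patternSum U g l (preRow q u lam') *
        rowKernel r.length (U v) (g v) lam lam' := by
    intro lam hlam
    rw [patternSum_cons]
    symm
    -- Only rows with the frozen initial block `u^{(q)}` have a nonzero kernel, so matching nonzero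
    -- terms is enough.
    refine Finset.sum_bij_ne_zero (fun lam' _ _ => preRow q u lam') ?_ ?_ ?_ ?_
    · intro lam' hlam' hne
      rw [← rowKernel_preRow (q := q) (U v) (g v) hlam hlam'] at hne
      rw [Finset.mem_filter, Finset.mem_Iic]
      refine ⟨?_, ?_⟩
      · by_contra h
        rw [rowKernel_eq_zero_of_not_le h, mul_zero] at hne
        exact hne rfl
      · intro j hj
        exact (mem_rowBox.1 hlam').1.preRow q u j (by omega)
    · exact fun _ _ _ _ _ _ h => preRow_injective _ _ h
    · intro μ hμ hne
      have hμ' := (Finset.mem_filter.1 hμ).2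
      have : rowKernel l.length (U v) (g v) μ (preRow (q + 2) u lam) ≠ 0 := right_ne_zero_of_mul hne
      obtain ⟨κ, hκ, hκ'⟩ := Finset.exists_ne_zero_of_sum_ne_zero this
      have hs := (ite_ne_right_iff.1 hκ').1
      have hlen2 := (mem_rowBox.1 hlam).1.preRow (q + 2) u
      obtain ⟨κ', h1, rfl⟩ := exists_eq_preRow_of_hStrip (q := q + 1) hlam hs.2
        (fun j hj => hlen2.of_le (Finset.mem_Iic.1 hκ) j (by omega))
      obtain ⟨μ', h2, rfl⟩ := exists_eq_preRow_of_hStrip (q := q) h1 hs.1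
        (fun j hj => hμ' j (by omega))
      have h3 : μ' ∈ rowBox (r.length + 1) u := by
        refine mem_rowBox.2 ⟨fun j hj => ?_, (mem_rowBox.1 h2).2⟩
        have := hμ' (j + q) (by omega)
        rwa [preRow_apply, if_neg (by omega), Nat.add_sub_cancel] at this
      refine ⟨μ', h3, ?_, rfl⟩
      rwa [← rowKernel_preRow (q := q) (U v) (g v) hlam h3, ← hl]
    · intro lam' hlam' _
      rw [hl, rowKernel_preRow (q := q) (U v) (g v) hlam hlam']
  have h2 : ∀ lam' ∈ rowBox (r.length + 1) u, patternSum U g (v :: r) lam' =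
      ∑ lam ∈ rowBox r.length u, patternSum U g r lam *
        rowKernel r.length (U v) (g v) lam lam' := by
    intro lam' hlam'
    rw [patternSum_cons]
    apply Finset.sum_subset
    · intro lam hlam
      simp only [Finset.mem_filter, Finset.mem_Iic] at hlam
      exact mem_rowBox.2 ⟨hlam.2, fun i => (hlam.1 i).trans ((mem_rowBox.1 hlam').2 i)⟩
    · intro lam hlam hlam''
      simp only [Finset.mem_filter, Finset.mem_Iic] at hlam''
      rw [rowKernel_eq_zero_of_not_le fun h => hlam'' ⟨h, (mem_rowBox.1 hlam).1⟩, mul_zero]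
  refine (Finset.sum_congr rfl fun lam hlam =>
    congrArg (· * patternSum U g r lam) (h1 lam hlam)).trans (Eq.trans ?_
    (Finset.sum_congr rfl fun lam' hlam' =>
      congrArg (patternSum U g l (preRow q u lam') * ·) (h2 lam' hlam')).symm)
  simp_rw [Finset.sum_mul, Finset.mul_sum]
  rw [Finset.sum_comm]
  exact Finset.sum_congr rfl fun _ _ => Finset.sum_congr rfl fun _ _ => by ring

/-- Rows are transferred from the bottom up, so the head of `b` ends up innermost in the second
pattern; hence the reversal. -/
theorem sum_patternSum_append (U : σ → Aˣ) (g : σ → ℕ → A) (u q : ℕ) (b l : List σ) :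
    ∀ r : List σ, l.length = q + r.length + b.length →
    ∑ lam ∈ rowBox r.length u,
      patternSum U g (b ++ l) (preRow (q + 2 * b.length) u lam) * patternSum U g r lam =
    ∑ lam ∈ rowBox (r.length + b.length) u,
      patternSum U g l (preRow q u lam) * patternSum U g (b.reverse ++ r) lam := by
  induction b with
  | nil => intro r _; simp
  | cons v b ih =>
    intro r hr
    simp only [List.length_cons] at hr
    have h1 := sum_patternSum_flip U g u (q + 2 * b.length) v (b ++ l) r
      (by rw [List.length_append]; omega)
    have h2 := ih (v :: r) (by rw [List.length_cons]; omega)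
    simp only [List.length_cons, List.cons_append, List.reverse_cons, List.append_assoc,
      List.nil_append] at h2 ⊢
    rw [show q + 2 * (b.length + 1) = q + 2 * b.length + 2 by ring, h1, h2,
      show r.length + 1 + b.length = r.length + (b.length + 1) by ring]

theorem rowBox_zero (u : ℕ) : rowBox 0 u = {0} := by
  ext lam
  rw [mem_rowBox, Finset.mem_singleton]
  constructor
  · intro h
    ext i
    exact h.1 i (Nat.zero_le i)
  · rintro rfl
    exact ⟨fun _ _ => rfl, fun _ => Nat.zero_le _⟩

/-- The decomposition of rectangular shapes. -/
theorem patternSum_append_rect {U : σ → Aˣ} {g : σ → ℕ → A} (hc : RowKernelsCommute U g)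
    (u q : ℕ) (b l : List σ) (hl : l.length = q + b.length) :
    patternSum U g (b ++ l) (preRow (b.length + l.length) u 0) =
      ∑ lam ∈ rowBox b.length u, patternSum U g l (preRow q u lam) * patternSum U g b lam := by
  have := sum_patternSum_append U g u q b l [] (by simpa using hl)
  simp only [List.length_nil, rowBox_zero, Finset.sum_singleton, zero_add, List.append_nil,
    patternSum, mul_one] at this
  rw [show b.length + l.length = q + 2 * b.length by omega, this]
  refine Finset.sum_congr rfl fun lam hlam => ?_
  -- Symmetry undoes the reversal caused by the flips.
  rw [patternSum_perm hc (List.reverse_perm b)]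
  rw [List.length_reverse]
  exact (mem_rowBox.1 hlam).1

/-! ### Cutting at an odd row. -/

/-- The generating function of patterns with an odd number of rows. -/
noncomputable def oddPatternSum (U : σ → Aˣ) (l : List σ) (s : σ) (κ : ℕ →₀ ℕ) : A :=
  ∑ μ ∈ (Finset.Iic κ).filter (LenLE l.length),
    patternSum U (fun _ _ => 1) l μ * stripKernel (U s) μ κ

/-- The sizes of the two full rows differ by `u + |lam| - |κ|`. Inverting `v` gives the exponent of
the reversed strip, and the one unmatched frozen entry leaves `v^{-u}`, the origin of the factor
`s^{-u}`. -/
theorem stripKernel_inv_preRow {q p u : ℕ} (v : Aˣ) {lam κ : ℕ →₀ ℕ}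
    (hlam : lam ∈ rowBox p u) (hκ : κ ∈ rowBox (p + 1) u) :
    stripKernel v⁻¹ (preRow q u κ) (preRow (q + 1) u lam) =
      ((v ^ (-u : ℤ) : Aˣ) : A) * stripKernel v lam κ := by
  simp only [stripKernel_apply, hStrip_preRow (mem_rowBox.1 hκ).2]
  split_ifs
  · rw [(mem_rowBox.1 hlam).1.degree_preRow, (mem_rowBox.1 hκ).1.degree_preRow, ← Units.val_mul,
      ← zpow_add, inv_zpow, ← zpow_neg]
    congr 2
    push_cast
    ring
  · simp

/-- By the invariance under inversion, the strip in `s` may precede the one in `s⁻¹`, as the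
positive exponent in an odd pattern requires. -/
theorem patternSum_cons_eq_odd (U : σ → Aˣ) (s : σ) (l : List σ) (ν : ℕ →₀ ℕ) :
    patternSum U (fun _ _ => 1) (s :: l) ν = ∑ κ ∈ Finset.Iic ν,
      oddPatternSum U l s κ * stripKernel (U s)⁻¹ κ ν := by
  rw [patternSum_cons]
  unfold oddPatternSum
  simp_rw [rowKernel_const, mul_one, Finset.sum_mul]
  have h1 : ∀ κ ∈ Finset.Iic ν, ∑ μ ∈ (Finset.Iic κ).filter (LenLE l.length),
      patternSum U (fun _ _ => 1) l μ * stripKernel (U s) μ κ * stripKernel (U s)⁻¹ κ ν =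
      ∑ μ ∈ (Finset.Iic ν).filter (LenLE l.length),
      patternSum U (fun _ _ => 1) l μ * stripKernel (U s) μ κ * stripKernel (U s)⁻¹ κ ν := by
    intro κ hκ
    apply Finset.sum_subset
    · intro μ hμ
      simp only [Finset.mem_filter, Finset.mem_Iic] at hμ hκ ⊢
      exact ⟨hμ.1.trans hκ, hμ.2⟩
    · intro μ hμ hμ'
      simp only [Finset.mem_filter, Finset.mem_Iic] at hμ hμ'
      rw [IncidenceAlgebra.apply_eq_zero_of_not_le fun h => hμ' ⟨h, hμ.2⟩]
      simp
  rw [Finset.sum_congr rfl h1, Finset.sum_comm]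
  refine Finset.sum_congr rfl fun μ _ => ?_
  rw [← doubleStripKernel_inv, doubleStripKernel, inv_inv, IncidenceAlgebra.mul_apply,
    Finset.mul_sum]
  simp_rw [mul_assoc]
  apply Finset.sum_subset
  · exact fun κ hκ => Finset.mem_Iic.2 (Finset.mem_Icc.1 hκ).2
  · intro κ hν hκ
    rw [IncidenceAlgebra.apply_eq_zero_of_not_le (f := stripKernel (U s)), zero_mul, mul_zero]
    exact fun h => hκ (Finset.mem_Icc.2 ⟨h, Finset.mem_Iic.1 hν⟩)

/-- Cut first at the even row just below the two rows of `s`, then move the lower strip of `s`,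
reversed, to the pattern in `b`. -/
theorem patternSum_append_cons_rect (U : σ → Aˣ) (u q : ℕ) (b l : List σ) (s : σ)
    (hl : l.length = q + b.length) :
    patternSum U (fun _ _ => 1) (b ++ s :: l) (preRow (b.length + l.length + 1) u 0) =
      ((U s ^ (-u : ℤ) : Aˣ) : A) * ∑ κ ∈ rowBox (b.length + 1) u,
        oddPatternSum U l s (preRow q u κ) * oddPatternSum U b s κ := by
  have := patternSum_append_rect (rowKernelsCommute_const U fun _ => 1) u (q + 1) b (s :: l)
    (by rw [List.length_cons]; omega)
  rw [List.length_cons, ← add_assoc] at this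
  rw [this]
  have h1 : ∀ lam ∈ rowBox b.length u,
      patternSum U (fun _ _ => 1) (s :: l) (preRow (q + 1) u lam) =
      ∑ κ ∈ rowBox (b.length + 1) u, oddPatternSum U l s (preRow q u κ) *
        (((U s ^ (-u : ℤ) : Aˣ) : A) * stripKernel (U s) lam κ) := by
    intro lam hlam
    rw [patternSum_cons_eq_odd]
    symm
    refine Finset.sum_bij_ne_zero (fun κ _ _ => preRow q u κ) ?_ ?_ ?_ ?_
    · intro κ hκ hne
      rw [← stripKernel_inv_preRow (q := q) (U s) hlam hκ] at hne
      rw [Finset.mem_Iic]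
      exact IncidenceAlgebra.le_of_ne_zero (right_ne_zero_of_mul hne)
    · exact fun _ _ _ _ _ _ h => preRow_injective _ _ h
    · intro κ hκ hne
      have h2 := right_ne_zero_of_mul hne
      rw [stripKernel_apply] at h2
      obtain ⟨κ', h3, rfl⟩ := exists_eq_preRow_of_hStrip hlam (ite_ne_right_iff.1 h2).1
        (fun j hj => ((mem_rowBox.1 hlam).1.preRow (q + 1) u).of_le (Finset.mem_Iic.1 hκ) j
          (by omega))
      refine ⟨κ', h3, ?_, rfl⟩
      rwa [← stripKernel_inv_preRow (q := q) (U s) hlam h3]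
    · intro κ hκ _
      rw [stripKernel_inv_preRow (q := q) (U s) hlam hκ]
  have h2 : ∀ κ ∈ rowBox (b.length + 1) u, oddPatternSum U b s κ =
      ∑ lam ∈ rowBox b.length u, patternSum U (fun _ _ => 1) b lam * stripKernel (U s) lam κ := by
    intro κ hκ
    apply Finset.sum_subset
    · intro lam hlam
      simp only [Finset.mem_filter, Finset.mem_Iic] at hlam
      exact mem_rowBox.2 ⟨hlam.2, fun i => (hlam.1 i).trans ((mem_rowBox.1 hκ).2 i)⟩
    · intro lam hlam hlam'
      simp only [Finset.mem_filter, Finset.mem_Iic] at hlam'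
      rw [IncidenceAlgebra.apply_eq_zero_of_not_le fun h => hlam' ⟨h, (mem_rowBox.1 hlam).1⟩,
        mul_zero]
  rw [Finset.mul_sum]
  refine (Finset.sum_congr rfl fun lam hlam =>
    congrArg (· * patternSum U (fun _ _ => 1) b lam) (h1 lam hlam)).trans (Eq.trans ?_
    (Finset.sum_congr rfl fun κ hκ =>
      congrArg (fun a => ((U s ^ (-u : ℤ) : Aˣ) : A) *
        (oddPatternSum U l s (preRow q u κ) * a)) (h2 κ hκ)).symm)
  simp_rw [Finset.sum_mul, Finset.mul_sum]
  rw [Finset.sum_comm]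
  exact Finset.sum_congr rfl fun _ _ => Finset.sum_congr rfl fun _ _ => by ring

end

/-! ### Adding rows to arrays -/

/-- The array `z` with its `N`-th row replaced by `r`. -/
def addRow (N : ℕ) (r : ℕ → ℚ) (z : ℕ → ℕ → ℚ) : ℕ → ℕ → ℚ :=
  fun i j => if i = N then r j else z i j

/-- Interlacing arrays of height `N` with bottom row `r`, whose entries satisfy `C`. -/
def patternsWith (N : ℕ) (C : ℕ → ℕ → ℚ → Prop) (r : ℕ → ℚ) : Set (ℕ → ℕ → ℚ) :=
  {z | IsArray N z ∧ (∀ i j, Idx N i j → C i j (z i j)) ∧ Interlacing N z ∧ z N = r}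

/-- The row `r` may follow the row `r'` of length `N` in an interlacing array. -/
def RowFollows (N : ℕ) (C : ℕ → ℕ → ℚ → Prop) (r' r : ℕ → ℚ) : Prop :=
  (∀ j, Idx (N + 1) (N + 1) j → C (N + 1) j (r j)) ∧ (∀ j, ¬ Idx (N + 1) (N + 1) j → r j = 0) ∧
    ∀ j, Idx N N j → r' j ≤ r j ∧ (Idx (N + 1) (N + 1) (j + 1) → r (j + 1) ≤ r' j)

theorem addRow_self (N : ℕ) (r : ℕ → ℚ) (z : ℕ → ℕ → ℚ) : addRow N r z N = r := by
  funext j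
  simp [addRow]

theorem addRow_of_ne {N i : ℕ} (h : i ≠ N) (r : ℕ → ℚ) (z : ℕ → ℕ → ℚ) :
    addRow N r z i = z i := by
  funext j
  simp [addRow, h]

theorem addRow_mem_patternsWith {N : ℕ} {C : ℕ → ℕ → ℚ → Prop} {r r' : ℕ → ℚ}
    {z : ℕ → ℕ → ℚ} (hr : RowFollows N C r' r) (hz : z ∈ patternsWith N C r') :
    addRow (N + 1) r z ∈ patternsWith (N + 1) C r := by
  obtain ⟨h1, h2, h3, h4⟩ := hz
  obtain ⟨g1, g2, g3⟩ := hr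
  have idx : ∀ {i j}, i ≠ N + 1 → (Idx (N + 1) i j ↔ Idx N i j) := by
    intro i j h; unfold Idx; omega
  refine ⟨fun i j hij => ?_, fun i j hij => ?_, ⟨fun i j h h' => ?_, fun i j h h' => ?_⟩,
    addRow_self _ _ _⟩
  · by_cases hi : i = N + 1
    · subst hi
      rw [addRow_self]
      exact g2 j hij
    · rw [addRow_of_ne hi]
      exact h1 i j (by rwa [← idx hi])
  · by_cases hi : i = N + 1
    · subst hi
      rw [addRow_self]
      exact g1 j hij
    · rw [addRow_of_ne hi]
      exact h2 i j (by rwa [← idx hi])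
  · have hi : i ≠ N + 1 := by unfold Idx at h'; omega
    rw [addRow_of_ne hi]
    by_cases hN : i = N
    · subst hN
      rw [addRow_self, h4]
      exact (g3 j ((idx hi).1 h)).1
    · rw [addRow_of_ne (by omega)]
      exact h3.1 i j ((idx hi).1 h) ((idx (by omega)).1 h')
  · have hi : i ≠ N + 1 := by unfold Idx at h'; omega
    rw [addRow_of_ne hi]
    by_cases hN : i = N
    · subst hN
      rw [addRow_self, h4]
      exact (g3 j ((idx hi).1 h)).2 h'
    · rw [addRow_of_ne (by omega)]
      exact h3.2 i j ((idx hi).1 h) ((idx (by omega)).1 h')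

theorem exists_addRow_eq {N : ℕ} {C : ℕ → ℕ → ℚ → Prop} {r : ℕ → ℚ} {z : ℕ → ℕ → ℚ}
    (hz : z ∈ patternsWith (N + 1) C r) :
    ∃ r' z', RowFollows N C r' r ∧ z' ∈ patternsWith N C r' ∧ addRow (N + 1) r z' = z := by
  obtain ⟨h1, h2, h3, h4⟩ := hz
  have idx : ∀ {i j}, i ≠ N + 1 → (Idx (N + 1) i j ↔ Idx N i j) := by
    intro i j h; unfold Idx; omega
  have hne : ∀ {i j}, Idx N i j → i ≠ N + 1 := by
    intro i j h; unfold Idx at h; omega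
  refine ⟨z N, addRow (N + 1) (fun _ => 0) z, ⟨?_, ?_, ?_⟩, ⟨?_, ?_, ⟨?_, ?_⟩, ?_⟩, ?_⟩
  · intro j hj
    rw [← h4]
    exact h2 _ _ hj
  · intro j hj
    rw [← h4]
    exact h1 _ _ hj
  · intro j hj
    rw [← h4]
    have hj' := (idx (hne hj)).2 hj
    exact ⟨h3.1 N j hj' (by unfold Idx at hj ⊢; omega), h3.2 N j hj'⟩
  · intro i j hij
    by_cases hi : i = N + 1
    · rw [hi, addRow_self]
    · rw [addRow_of_ne hi]
      exact h1 i j (by rwa [idx hi])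
  · intro i j hij
    rw [addRow_of_ne (hne hij)]
    exact h2 i j ((idx (hne hij)).2 hij)
  · intro i j h h'
    rw [addRow_of_ne (hne h), addRow_of_ne (hne h')]
    exact h3.1 i j ((idx (hne h)).2 h) ((idx (hne h')).2 h')
  · intro i j h h'
    rw [addRow_of_ne (hne h), addRow_of_ne (hne h')]
    exact h3.2 i j ((idx (hne h)).2 h) ((idx (hne h')).2 h')
  · rw [addRow_of_ne (by omega)]
  · funext i
    by_cases hi : i = N + 1
    · rw [hi, addRow_self, h4]
    · rw [addRow_of_ne hi, addRow_of_ne hi]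

theorem addRow_injOn (N : ℕ) (r : ℕ → ℚ) :
    Set.InjOn (addRow (N + 1) r) {z | IsArray N z} := by
  intro z hz z' hz' h
  funext i
  by_cases hi : i = N + 1
  · funext j
    rw [hz i j (by unfold Idx; omega), hz' i j (by unfold Idx; omega)]
  · rw [← addRow_of_ne hi r z, h, addRow_of_ne hi]

/-- Deleting the bottom row and grouping by the new one is the induction step for all array sums.
The array `z'` in `hS'` is what guarantees the entry conditions on `r'`. -/
theorem finsum_patternsWith_succ {α A : Type*} [AddCommMonoid A] {N : ℕ}
    {C : ℕ → ℕ → ℚ → Prop} {r : ℕ → ℚ} (S : Finset α) (row : α → ℕ → ℚ)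
    (hinj : Set.InjOn row S) (hS : ∀ a ∈ S, RowFollows N C (row a) r)
    (hS' : ∀ r' z', RowFollows N C r' r → z' ∈ patternsWith N C r' → ∃ a ∈ S, row a = r')
    (hfin : ∀ a ∈ S, (patternsWith N C (row a)).Finite) (f : (ℕ → ℕ → ℚ) → A) :
    ∑ᶠ z ∈ patternsWith (N + 1) C r, f z =
      ∑ a ∈ S, ∑ᶠ z ∈ patternsWith N C (row a), f (addRow (N + 1) r z) := by
  have h1 : patternsWith (N + 1) C r =
      ⋃ a ∈ (S : Set α), addRow (N + 1) r '' patternsWith N C (row a) := by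
    ext z
    simp only [Set.mem_iUnion, Set.mem_image, exists_prop]
    constructor
    · intro hz
      obtain ⟨r', z', h, h', e⟩ := exists_addRow_eq hz
      obtain ⟨a, ha, rfl⟩ := hS' r' z' h h'
      exact ⟨a, ha, z', h', e⟩
    · rintro ⟨a, ha, z', h', rfl⟩
      exact addRow_mem_patternsWith (hS a ha) h'
  rw [h1, finsum_mem_biUnion, finsum_mem_coe_finset]
  · refine Finset.sum_congr rfl fun a ha => ?_
    rw [finsum_mem_image]
    exact (addRow_injOn N r).mono fun z hz => hz.1
  · intro a ha b hb hab
    refine Set.disjoint_left.2 ?_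
    rintro _ ⟨z, hz, rfl⟩ ⟨z', hz', e⟩
    have := addRow_injOn N r hz'.1 hz.1 e
    subst this
    exact hab (hinj ha hb (hz.2.2.2.symm.trans hz'.2.2.2))
  · exact S.finite_toSet
  · exact fun a ha => (hfin a ha).image _

theorem patternsWith_zero (C : ℕ → ℕ → ℚ → Prop) : patternsWith 0 C 0 = {0} := by
  ext z
  rw [Set.mem_singleton_iff]
  constructor
  · rintro ⟨h, -⟩
    funext i j
    exact h i j (by unfold Idx; omega)
  · rintro rfl
    refine ⟨fun _ _ _ => rfl, fun i j h => ?_, ⟨fun _ _ _ _ => le_rfl, fun _ _ _ _ => le_rfl⟩, rfl⟩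
    unfold Idx at h
    omega

theorem rowSum_addRow_of_ne {N i : ℕ} (h : i ≠ N) (r : ℕ → ℚ) (z : ℕ → ℕ → ℚ) :
    rowSum (addRow N r z) i = rowSum z i := by
  unfold rowSum
  rw [addRow_of_ne h]

/-! ### Rows of integers and half-integers -/

/-- The row `(λ_1 + h/2, …, λ_l + h/2 - e/2)` of length `l`. -/
def halfRow (l h e : ℕ) (lam : ℕ →₀ ℕ) : ℕ → ℚ :=
  fun j => if 1 ≤ j ∧ j ≤ l then (lam (j - 1) : ℚ) + h / 2 - (if j = l then (e : ℚ) / 2 else 0)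
    else 0

theorem halfRow_of_not {l h e : ℕ} {lam : ℕ →₀ ℕ} {j : ℕ} (hj : ¬ (1 ≤ j ∧ j ≤ l)) :
    halfRow l h e lam j = 0 := if_neg hj

theorem halfRow_succ_of_lt {l h e : ℕ} {lam : ℕ →₀ ℕ} {i : ℕ} (hi : i + 1 < l) :
    halfRow l h e lam (i + 1) = lam i + h / 2 := by
  rw [halfRow, if_pos (by omega), if_neg (by omega), Nat.add_sub_cancel, sub_zero]

theorem halfRow_zero_succ {l h : ℕ} {lam : ℕ →₀ ℕ} {i : ℕ} (hi : i < l) :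
    halfRow l h 0 lam (i + 1) = lam i + h / 2 := by
  rw [halfRow, if_pos (by omega), Nat.add_sub_cancel]
  simp

theorem halfRow_last {l h e : ℕ} {lam : ℕ →₀ ℕ} :
    halfRow (l + 1) h e lam (l + 1) = lam l + h / 2 - e / 2 := by
  rw [halfRow, if_pos (by omega), if_pos rfl, Nat.add_sub_cancel]

theorem sum_halfRow {l h : ℕ} {lam : ℕ →₀ ℕ} (hlam : LenLE l lam) :
    ∑ j ∈ Finset.Icc 1 l, halfRow l h 0 lam j = lam.degree + l * h / 2 := by
  rw [hlam.degree_eq, ← Finset.Ico_succ_right_eq_Icc, Nat.succ_eq_succ, Finset.sum_Ico_eq_sum_range]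
  simp only [Nat.succ_eq_add_one, Nat.add_sub_cancel]
  rw [Finset.sum_congr rfl fun i hi => by
    rw [add_comm, halfRow_zero_succ (Finset.mem_range.1 hi)]]
  rw [Finset.sum_add_distrib]
  simp
  ring

theorem sum_halfRow_succ {l h e : ℕ} {lam : ℕ →₀ ℕ} (hlam : LenLE (l + 1) lam) :
    ∑ j ∈ Finset.Icc 1 (l + 1), halfRow (l + 1) h e lam j =
      lam.degree + (l + 1) * h / 2 - e / 2 := by
  have h1 := sum_halfRow (h := h) hlam
  rw [Finset.sum_Icc_succ_top (by omega)] at h1 ⊢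
  have h2 : ∑ j ∈ Finset.Icc 1 l, halfRow (l + 1) h e lam j =
      ∑ j ∈ Finset.Icc 1 l, halfRow (l + 1) h 0 lam j := by
    refine Finset.sum_congr rfl fun j hj => ?_
    obtain ⟨i, rfl⟩ : ∃ i, j = i + 1 := ⟨j - 1, by have := (Finset.mem_Icc.1 hj).1; omega⟩
    have := (Finset.mem_Icc.1 hj).2
    rw [halfRow_succ_of_lt (by omega), halfRow_succ_of_lt (by omega)]
  rw [halfRow_last] at h1 ⊢
  rw [h2]
  push_cast at h1 ⊢
  linarith

/-- Odd ends are bounded by other entries only from above, and rounding one up to the grid `ℕ + h/2`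
does not affect such a bound when the other side lies on the grid. Interlacing thus becomes a
condition on integer rows. -/
theorem sub_half_le_iff {a b h e : ℕ} (he : e ≤ 1) :
    (a : ℚ) + h / 2 - e / 2 ≤ b + h / 2 ↔ a ≤ b := by
  have he' : (e : ℚ) ≤ 1 := by exact_mod_cast he
  have he0 : (0 : ℚ) ≤ e := by positivity
  constructor
  · intro hab
    by_contra hlt
    have : (b : ℚ) + 1 ≤ a := by exact_mod_cast (not_le.1 hlt)
    linarith
  · intro hab
    have : (a : ℚ) ≤ b := by exact_mod_cast hab
    linarith

theorem add_half_le_iff {a b h : ℕ} : (a : ℚ) + h / 2 ≤ b + h / 2 ↔ a ≤ b := by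
  have := sub_half_le_iff (a := a) (b := b) (h := h) (Nat.zero_le 1)
  rwa [Nat.cast_zero, zero_div, sub_zero] at this

/-- The row of length `n + 1` above an even row of the same length. -/
theorem halfRow_interlace_even {n h e : ℕ} (he : e ≤ 1) {κ lam : ℕ →₀ ℕ}
    (hκ : LenLE (n + 1) κ) (hlam : LenLE (n + 1) lam) :
    (∀ j, Idx (2 * n + 1) (2 * n + 1) j → halfRow (n + 1) h e κ j ≤ halfRow (n + 1) h 0 lam j ∧
      (Idx (2 * n + 1 + 1) (2 * n + 1 + 1) (j + 1) →
        halfRow (n + 1) h 0 lam (j + 1) ≤ halfRow (n + 1) h e κ j)) ↔ HStrip κ lam := by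
  constructor
  · intro H j
    rcases lt_trichotomy j n with hj | rfl | hj
    · have := H (j + 1) (by unfold Idx; omega)
      rw [halfRow_zero_succ (by omega), halfRow_zero_succ (by omega),
        halfRow_succ_of_lt (by omega), add_half_le_iff, add_half_le_iff] at this
      exact ⟨this.2 (by unfold Idx; omega), this.1⟩
    · have := (H (j + 1) (by unfold Idx; omega)).1
      rw [halfRow_zero_succ (by omega), halfRow_last, sub_half_le_iff he] at this
      exact ⟨by rw [hlam _ le_rfl]; omega, this⟩
    · rw [hlam _ (by omega), hκ _ (by omega)]
      omega
  · intro H j hj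
    obtain ⟨i, rfl⟩ : ∃ i, j = i + 1 := ⟨j - 1, by unfold Idx at hj; omega⟩
    by_cases hi : i = n
    · subst hi
      rw [halfRow_zero_succ (by omega), halfRow_last, sub_half_le_iff he]
      exact ⟨(H i).2, fun h => by unfold Idx at h; omega⟩
    · have hi' : i + 1 < n + 1 := by unfold Idx at hj; omega
      rw [halfRow_zero_succ (by omega), halfRow_zero_succ hi',
        halfRow_succ_of_lt (by omega), add_half_le_iff, add_half_le_iff]
      exact ⟨(H i).2, fun _ => (H i).1⟩

/-- The row of length `n` above an odd row of length `n + 1`. -/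
theorem halfRow_interlace_odd {n h e : ℕ} (he : e ≤ 1) {μ κ : ℕ →₀ ℕ}
    (hμ : LenLE n μ) (hκ : LenLE (n + 1) κ) :
    (∀ j, Idx (2 * n) (2 * n) j → halfRow n h 0 μ j ≤ halfRow (n + 1) h e κ j ∧
      (Idx (2 * n + 1) (2 * n + 1) (j + 1) →
        halfRow (n + 1) h e κ (j + 1) ≤ halfRow n h 0 μ j)) ↔ HStrip μ κ := by
  constructor
  · intro H j
    by_cases hj : j < n
    · have := H (j + 1) (by unfold Idx; omega)
      rw [halfRow_zero_succ (by omega), halfRow_succ_of_lt (by omega), add_half_le_iff] at this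
      refine ⟨?_, this.1⟩
      have := this.2 (by unfold Idx; omega)
      by_cases hj' : j + 1 = n
      · subst hj'
        rwa [halfRow_last, sub_half_le_iff he] at this
      · rwa [halfRow_succ_of_lt (by omega), add_half_le_iff] at this
    · rw [hμ _ (by omega), hκ _ (by omega)]
      omega
  · intro H j hj
    obtain ⟨i, rfl⟩ : ∃ i, j = i + 1 := ⟨j - 1, by unfold Idx at hj; omega⟩
    have hi : i < n := by unfold Idx at hj; omega
    rw [halfRow_zero_succ hi, halfRow_succ_of_lt (by omega), add_half_le_iff]
    refine ⟨(H i).2, fun _ => ?_⟩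
    by_cases hj' : i + 1 = n
    · subst hj'
      rw [halfRow_last, sub_half_le_iff he]
      exact (H i).1
    · rw [halfRow_succ_of_lt (by omega), add_half_le_iff]
      exact (H i).1

theorem halfRow_zero_injOn (l h : ℕ) : Set.InjOn (halfRow l h 0) {lam | LenLE l lam} := by
  intro lam hlam lam' hlam' H
  ext i
  by_cases hi : i < l
  · have := congrFun H (i + 1)
    rw [halfRow_zero_succ hi, halfRow_zero_succ hi, add_left_inj] at this
    exact_mod_cast this
  · rw [hlam i (by omega), hlam' i (by omega)]

theorem halfRow_eq_halfRow {l h e e' : ℕ} (he : e ≤ 1) (he' : e' ≤ 1) {lam lam' : ℕ →₀ ℕ}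
    (hlam : LenLE (l + 1) lam) (hlam' : LenLE (l + 1) lam')
    (H : halfRow (l + 1) h e lam = halfRow (l + 1) h e' lam') : lam = lam' ∧ e = e' := by
  have h1 : lam l = lam' l ∧ e = e' := by
    have := congrFun H (l + 1)
    rw [halfRow_last, halfRow_last] at this
    have h2 : 2 * (lam l : ℚ) + e' = 2 * lam' l + e := by linarith
    have h3 : 2 * lam l + e' = 2 * lam' l + e := by exact_mod_cast h2
    omega
  refine ⟨?_, h1.2⟩
  ext i
  rcases lt_trichotomy i l with hi | rfl | hi
  · have := congrFun H (i + 1)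
    rw [halfRow_succ_of_lt (by omega), halfRow_succ_of_lt (by omega), add_left_inj] at this
    exact_mod_cast this
  · exact h1.1
  · rw [hlam i (by omega), hlam' i (by omega)]

theorem exists_halfRow_zero {l h : ℕ} {r : ℕ → ℚ} (h0 : ∀ j, ¬ (1 ≤ j ∧ j ≤ l) → r j = 0)
    (h1 : ∀ j, 1 ≤ j → j ≤ l → ∃ k : ℕ, r j = k + h / 2) :
    ∃ lam, LenLE l lam ∧ halfRow l h 0 lam = r := by
  choose! f hf using h1
  refine ⟨Finsupp.onFinset (Finset.range l) (fun i => if i < l then f (i + 1) else 0) ?_,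
    fun j hj => ?_, ?_⟩
  · intro i hi
    by_contra hn
    simp only [Finset.mem_range] at hn
    simp [hn] at hi
  · simp [show ¬ j < l by omega]
  · funext j
    by_cases hj : 1 ≤ j ∧ j ≤ l
    · obtain ⟨i, rfl⟩ : ∃ i, j = i + 1 := ⟨j - 1, by omega⟩
      rw [halfRow_zero_succ (by omega), hf _ hj.1 hj.2]
      simp [show i < l by omega]
    · rw [halfRow_of_not hj, h0 j hj]

theorem exists_halfRow {l h : ℕ} (hh : h ≤ 1) {r : ℕ → ℚ}
    (h0 : ∀ j, ¬ (1 ≤ j ∧ j ≤ l + 1) → r j = 0)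
    (h1 : ∀ j, 1 ≤ j → j ≤ l → ∃ k : ℕ, r j = k + h / 2) (h2 : IsHalfNat (r (l + 1))) :
    ∃ lam e, LenLE (l + 1) lam ∧ e ≤ 1 ∧ e ≤ lam l + h ∧ halfRow (l + 1) h e lam = r := by
  obtain ⟨k, hk⟩ := h2
  obtain ⟨a, e, he, hae, hr⟩ : ∃ a e : ℕ, e ≤ 1 ∧ e ≤ a + h ∧ r (l + 1) = a + h / 2 - e / 2 := by
    -- The first witness is `(k - h)/2` rounded up, the second the rounding excess; `e ≤ a + h`
    -- encodes that the odd end is non-negative.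
    refine ⟨(k + 1 - h) / 2, 2 * ((k + 1 - h) / 2) + h - k, by omega,
      by omega, ?_⟩
    rw [hk]
    have : 2 * ((k + 1 - h) / 2) + h = k + (2 * ((k + 1 - h) / 2) + h - k) := by omega
    have h3 : (2 * ((k + 1 - h) / 2 : ℕ) + h : ℚ) =
      k + (2 * ((k + 1 - h) / 2) + h - k : ℕ) := by exact_mod_cast this
    linarith
  obtain ⟨lam, hlam, hrow⟩ := exists_halfRow_zero (l := l + 1) (h := h)
    (r := Function.update r (l + 1) (a + h / 2)) (fun j hj => by
      rw [Function.update_of_ne (by omega)]; exact h0 j hj) (fun j hj hj' => by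
      by_cases hjl : j = l + 1
      · subst hjl
        exact ⟨a, by rw [Function.update_self]⟩
      · rw [Function.update_of_ne hjl]
        exact h1 j hj (by omega))
  have hla : lam l = a := by
    have := congrFun hrow (l + 1)
    rw [halfRow_zero_succ (by omega), Function.update_self, add_left_inj] at this
    exact_mod_cast this
  refine ⟨lam, e, hlam, he, by omega, ?_⟩
  funext j
  by_cases hjl : j = l + 1
  · subst hjl
    rw [halfRow_last, hr, hla]
  · have := congrFun hrow j
    rw [Function.update_of_ne hjl] at this
    rw [← this]
    simp [halfRow, hjl]

/-! ### Variables as units and weights of odd ends. -/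

section

variable (R : Type*) [CommRing R] {σ : Type*}

theorem vpow_zero (v : σ) : vpow R v 0 = 1 := by
  rw [vpow, Finsupp.single_zero, AddMonoidAlgebra.one_def]

theorem vpow_add (v : σ) (p q : ℚ) : vpow R v (p + q) = vpow R v p * vpow R v q := by
  rw [vpow, vpow, vpow, AddMonoidAlgebra.single_mul_single, Finsupp.single_add, mul_one]

/-- The powers of a variable as a homomorphism. -/
noncomputable def vpowHom (v : σ) : Multiplicative ℚ →* Poly R σ where
  toFun q := vpow R v q.toAdd
  map_one' := vpow_zero R v
  map_mul' p q := vpow_add R v p.toAdd q.toAdd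

/-- A variable as a unit of the ring of Laurent polynomials. -/
noncomputable def varUnit (v : σ) : (Poly R σ)ˣ :=
  (vpowHom R v).toHomUnits (Multiplicative.ofAdd 1)

theorem val_varUnit_zpow (v : σ) (k : ℤ) :
    ((varUnit R v ^ k : (Poly R σ)ˣ) : Poly R σ) = vpow R v k := by
  rw [varUnit, ← map_zpow, MonoidHom.coe_toHomUnits, ← ofAdd_zsmul]
  simp [vpowHom]

theorem val_varUnit (v : σ) : (varUnit R v : Poly R σ) = vpow R v 1 := by
  simpa using val_varUnit_zpow R v 1

/-- The weight of the odd ends of split orthogonal patterns: `h = 0` for integral shapes and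
`h = 1` for half-integral ones. -/
noncomputable def endWeight (h : ℕ) (β : R) (v : σ) (c : ℕ) : Poly R σ :=
  ∑ e ∈ (Finset.range 2).filter (fun e => e ≤ c + h), β ^ e • vpow R v (e - h / 2)

theorem endWeight_zero (β : R) (v : σ) (c : ℕ) : endWeight R 0 β v c =
    if c = 0 then 1 else 1 + algebraMap R (Poly R σ) β * varUnit R v := by
  unfold endWeight
  rw [Finset.sum_filter, Finset.sum_range_succ, Finset.sum_range_one, val_varUnit]
  by_cases hc : c = 0
  · simp [hc, vpow_zero]
  · simp [hc, vpow_zero, Algebra.smul_def, show 1 ≤ c by omega]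
    rfl

/-- For half-integral shapes the condition `e ≤ c + 1` is void, so the weight does not depend on the
odd end. -/
theorem endWeight_one (β : R) (v : σ) (c : ℕ) :
    endWeight R 1 β v c = vpow R v (-1 / 2) + β • vpow R v (1 / 2) := by
  unfold endWeight
  rw [Finset.sum_filter, Finset.sum_range_succ, Finset.sum_range_one]
  norm_num

theorem rowKernelsCommute_endWeight {h : ℕ} (hh : h ≤ 1) (β : R) :
    RowKernelsCommute (varUnit R (σ := σ)) (endWeight R h β) := by
  obtain rfl | rfl : h = 0 ∨ h = 1 := by omega
  · have := rowKernelsCommute_cb (varUnit R (σ := σ)) (algebraMap R (Poly R σ) β)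
    have e : endWeight R 0 β = fun (v : σ) c => if c = 0 then 1 else
      1 + algebraMap R (Poly R σ) β * varUnit R v := by
      funext v c
      exact endWeight_zero R β v c
    rwa [e]
  · have e : endWeight R 1 β = fun (v : σ) _ => vpow R v (-1 / 2) + β • vpow R v (1 / 2) := by
      funext v c
      exact endWeight_one R β v c
    rw [e]
    exact rowKernelsCommute_const _ _

end

/-! ### Split orthogonal patterns as chains of rows -/

open Classical in
/-- The condition on the entries of split orthogonal patterns of shape in `h/2 + ℤ`. -/
noncomputable def soEntry (h : ℕ) (i j : ℕ) (q : ℚ) : Prop :=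
  if IsOddEnd i j then IsHalfNat q else ∃ k : ℕ, q = k + h / 2

theorem isNonnegInt_add_half {a h : ℕ} (hh : h ≤ 1) : IsNonnegInt ((a : ℚ) + h / 2) ↔ h = 0 := by
  constructor
  · rintro ⟨k, hk⟩
    have h1 : 2 * (a : ℚ) + h = 2 * k := by linarith
    have h2 : 2 * a + h = 2 * k := by exact_mod_cast h1
    omega
  · rintro rfl
    exact ⟨a, by simp⟩

theorem isNonnegHalfInt_add_half {a h : ℕ} (hh : h ≤ 1) :
    IsNonnegHalfInt ((a : ℚ) + h / 2) ↔ h = 1 := by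
  constructor
  · rintro ⟨k, hk⟩
    have h1 : 2 * (a : ℚ) + h = 2 * k + 1 := by linarith
    have h2 : 2 * a + h = 2 * k + 1 := by exact_mod_cast h1
    omega
  · rintro rfl
    exact ⟨a, by simp⟩

theorem soGT_eq_patternsWith {n h : ℕ} (hh : h ≤ 1) (lam : ℕ →₀ ℕ) :
    soGT n (fun i => (lam i : ℚ) + h / 2) = patternsWith (2 * n) (soEntry h) (halfRow n h 0 lam) := by
  ext z
  constructor
  · rintro ⟨h1, h2, h3, h4, h5⟩
    have hrow : z (2 * n) = halfRow n h 0 lam := by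
      funext j
      by_cases hj : 1 ≤ j ∧ j ≤ n
      · obtain ⟨i, rfl⟩ : ∃ i, j = i + 1 := ⟨j - 1, by omega⟩
        rw [halfRow_zero_succ (by omega)]
        exact h5 ⟨i, by omega⟩
      · rw [halfRow_of_not hj]
        exact h1 _ _ (by unfold Idx; omega)
    refine ⟨h1, fun i j hij => ?_, h4, hrow⟩
    unfold soEntry
    split_ifs with ho
    · exact h2 i j hij ho
    · have hn : 0 < n := by unfold Idx at hij; omega
      have hz : z (2 * n) 1 = lam 0 + h / 2 := by
        rw [hrow]; exact halfRow_zero_succ hn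
      have hi1 : Idx (2 * n) (2 * n) 1 := by unfold Idx; omega
      have hi2 : ¬ IsOddEnd (2 * n) 1 := by unfold IsOddEnd; omega
      rcases h3 with h3 | h3
      · have := h3 _ _ hi1 hi2
        rw [hz, isNonnegInt_add_half hh] at this
        obtain ⟨k, hk⟩ := h3 i j hij ho
        exact ⟨k, by simp [hk, this]⟩
      · have := h3 _ _ hi1 hi2
        rw [hz, isNonnegHalfInt_add_half hh] at this
        obtain ⟨k, hk⟩ := h3 i j hij ho
        exact ⟨k, by simp [hk, this]⟩
  · rintro ⟨h1, h2, h3, h4⟩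
    unfold soEntry at h2
    refine ⟨h1, fun i j hij ho => by simpa [ho] using h2 i j hij, ?_, h3, fun j => ?_⟩
    · obtain rfl | rfl : h = 0 ∨ h = 1 := by omega
      · refine Or.inl fun i j hij ho => ?_
        obtain ⟨k, hk⟩ := by simpa only [ho, if_false] using h2 i j hij
        exact ⟨k, by simp [hk]⟩
      · refine Or.inr fun i j hij ho => ?_
        obtain ⟨k, hk⟩ := by simpa only [ho, if_false] using h2 i j hij
        exact ⟨k, by simp [hk]⟩
    · rw [h4, halfRow_zero_succ j.2]

/-- The entry `q` is atypical in a pattern of shape in `h/2 + ℤ`. -/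
def IsAtypicalEntry (h : ℕ) (q : ℚ) : Prop :=
  (h = 0 ∧ IsNonnegHalfInt q) ∨ (h = 1 ∧ IsNonnegInt q)

open Classical in
/-- The number of atypical odd ends in a pattern of shape in `h/2 + ℤ`. -/
noncomputable def atypCountOf (h n : ℕ) (z : ℕ → ℕ → ℚ) : ℕ :=
  ((Finset.Icc 1 n).filter fun k => IsAtypicalEntry h (z (2 * k - 1) k)).card

theorem atypCount_eq_atypCountOf {n h : ℕ} (hh : h ≤ 1) {lam : ℕ →₀ ℕ} {z : ℕ → ℕ → ℚ}
    (hz : z (2 * n) = halfRow n h 0 lam) : atypCount n z = atypCountOf h n z := by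
  classical
  unfold atypCount atypCountOf
  congr 1
  refine Finset.filter_congr fun k hk => ?_
  have hn : 0 < n := by have := Finset.mem_Icc.1 hk; omega
  have h1 : z (2 * n) 1 = lam 0 + h / 2 := by
    rw [hz]; exact halfRow_zero_succ hn
  rw [IsAtypical, h1, isNonnegInt_add_half hh, isNonnegHalfInt_add_half hh, IsAtypicalEntry]

theorem isAtypicalEntry_iff {h e a : ℕ} (hh : h ≤ 1) (he : e ≤ 1) (hea : e ≤ a + h) :
    IsAtypicalEntry h ((a : ℚ) + h / 2 - e / 2) ↔ e = 1 := by
  constructor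
  · rintro (⟨rfl, k, hk⟩ | ⟨rfl, k, hk⟩)
    · have h1 : 2 * (a : ℚ) = 2 * k + 1 + e := by push_cast at hk; linarith
      have h2 : 2 * a = 2 * k + 1 + e := by exact_mod_cast h1
      omega
    · have h1 : 2 * (a : ℚ) + 1 = 2 * k + e := by push_cast at hk; linarith
      have h2 : 2 * a + 1 = 2 * k + e := by exact_mod_cast h1
      omega
  · rintro rfl
    obtain rfl | rfl : h = 0 ∨ h = 1 := by omega
    · obtain ⟨b, rfl⟩ : ∃ b, a = b + 1 := ⟨a - 1, by omega⟩
      exact Or.inl ⟨rfl, b, by push_cast; ring⟩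
    · exact Or.inr ⟨rfl, a, by push_cast; ring⟩

theorem patternsWith_soEntry_finite {n h : ℕ} (hh : h ≤ 1) (lam : ℕ →₀ ℕ) :
    (patternsWith (2 * n) (soEntry h) (halfRow n h 0 lam)).Finite := by
  rw [← soGT_eq_patternsWith hh]
  exact soGT_finite _ _

theorem soEntry.isHalfNat {h i j : ℕ} {q : ℚ} (hq : soEntry h i j q) : IsHalfNat q := by
  unfold soEntry at hq
  split_ifs at hq
  · exact hq
  · obtain ⟨k, rfl⟩ := hq
    exact ⟨2 * k + h, by push_cast; ring⟩

theorem patternsWith_odd_finite {n h e : ℕ} {C : ℕ → ℕ → ℚ → Prop}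
    (hC : ∀ i j q, C i j q → IsHalfNat q) (κ : ℕ →₀ ℕ) :
    (patternsWith (2 * n + 1) C (halfRow (n + 1) h e κ)).Finite := by
  refine finite_patterns (2 * n + 1) (l := n + 1) (by omega)
    (fun j => halfRow (n + 1) h e κ (j + 1)) _ fun z hz => ?_
  obtain ⟨h1, h2, h3, h4⟩ := hz
  exact ⟨h1, fun i j hij => hC i j _ (h2 i j hij), h3, fun j => by rw [h4]⟩

theorem finsum_soPatterns_odd_step {A : Type*} [AddCommMonoid A] {n h : ℕ} (hh : h ≤ 1)
    {lam : ℕ →₀ ℕ} (hlam : LenLE (n + 1) lam) (f : (ℕ → ℕ → ℚ) → A) :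
    ∑ᶠ z ∈ patternsWith (2 * n + 1 + 1) (soEntry h) (halfRow (n + 1) h 0 lam), f z =
      ∑ a ∈ (Finset.Iic lam ×ˢ Finset.range 2).filter
          (fun a => HStrip a.1 lam ∧ a.2 ≤ a.1 n + h),
        ∑ᶠ z ∈ patternsWith (2 * n + 1) (soEntry h) (halfRow (n + 1) h a.2 a.1),
          f (addRow (2 * n + 1 + 1) (halfRow (n + 1) h 0 lam) z) := by
  apply finsum_patternsWith_succ (row := fun a : (ℕ →₀ ℕ) × ℕ => halfRow (n + 1) h a.2 a.1)
  · rintro ⟨κ, e⟩ ha ⟨κ', e'⟩ ha' H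
    simp only [Finset.coe_filter, Finset.mem_product, Finset.mem_Iic, Finset.mem_range,
      Set.mem_ofPred_eq] at ha ha'
    obtain ⟨rfl, rfl⟩ := halfRow_eq_halfRow (by omega) (by omega) (hlam.of_le ha.1.1)
      (hlam.of_le ha'.1.1) H
    rfl
  · rintro ⟨κ, e⟩ ha
    simp only [Finset.mem_filter, Finset.mem_product, Finset.mem_Iic, Finset.mem_range] at ha
    refine ⟨fun j hj => ?_, fun j hj => halfRow_of_not (by unfold Idx at hj; omega),
      (halfRow_interlace_even (by omega) (hlam.of_le ha.1.1) hlam).2 ha.2.1⟩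
    rw [soEntry, if_neg (by unfold IsOddEnd; omega)]
    obtain ⟨i, rfl⟩ : ∃ i, j = i + 1 := ⟨j - 1, by unfold Idx at hj; omega⟩
    exact ⟨lam i, halfRow_zero_succ (by unfold Idx at hj; omega)⟩
  · rintro r' z' hr ⟨h1, h2, h3, rfl⟩
    obtain ⟨κ, e, hκ, he, hea, hrow⟩ := exists_halfRow (l := n) hh (r := z' (2 * n + 1))
      (fun j hj => h1 _ _ (by unfold Idx; omega))
      (fun j hj hj' => by
        have := h2 (2 * n + 1) j (by unfold Idx; omega)
        rwa [soEntry, if_neg (by unfold IsOddEnd; omega)] at this)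
      (h2 _ _ (by unfold Idx; omega)).isHalfNat
    have hs : HStrip κ lam := by
      rw [← halfRow_interlace_even he hκ hlam (h := h), hrow]
      exact hr.2.2
    exact ⟨(κ, e), by simpa using ⟨⟨hs.le, by omega⟩, hs, hea⟩, hrow⟩
  · exact fun a _ => patternsWith_odd_finite (fun i j q hq => hq.isHalfNat) _

theorem finsum_soPatterns_even_step {A : Type*} [AddCommMonoid A] {n h e : ℕ} (hh : h ≤ 1)
    (he : e ≤ 1) {κ : ℕ →₀ ℕ} (hκ : LenLE (n + 1) κ) (hea : e ≤ κ n + h)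
    (f : (ℕ → ℕ → ℚ) → A) :
    ∑ᶠ z ∈ patternsWith (2 * n + 1) (soEntry h) (halfRow (n + 1) h e κ), f z =
      ∑ μ ∈ (Finset.Iic κ).filter (fun μ => LenLE n μ ∧ HStrip μ κ),
        ∑ᶠ z ∈ patternsWith (2 * n) (soEntry h) (halfRow n h 0 μ),
          f (addRow (2 * n + 1) (halfRow (n + 1) h e κ) z) := by
  apply finsum_patternsWith_succ
  · exact (halfRow_zero_injOn n h).mono fun μ hμ => (Finset.mem_filter.1 hμ).2.1
  · intro μ hμ
    simp only [Finset.mem_filter] at hμ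
    refine ⟨fun j hj => ?_, fun j hj => halfRow_of_not (by unfold Idx at hj; omega),
      (halfRow_interlace_odd he hμ.2.1 hκ).2 hμ.2.2⟩
    obtain ⟨i, rfl⟩ : ∃ i, j = i + 1 := ⟨j - 1, by unfold Idx at hj; omega⟩
    unfold soEntry
    split_ifs with ho
    · have : i = n := by unfold IsOddEnd at ho; omega
      subst this
      refine ⟨2 * κ i + h - e, ?_⟩
      rw [halfRow_last, Nat.cast_sub (by omega)]
      push_cast
      ring
    · exact ⟨κ i, halfRow_succ_of_lt (by unfold Idx at hj; unfold IsOddEnd at ho; omega)⟩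
  · rintro r' z' hr ⟨h1, h2, h3, rfl⟩
    obtain ⟨μ, hμ, hrow⟩ := exists_halfRow_zero (l := n) (h := h) (r := z' (2 * n))
      (fun j hj => h1 _ _ (by unfold Idx; omega))
      (fun j hj hj' => by
        have := h2 (2 * n) j (by unfold Idx; omega)
        rwa [soEntry, if_neg (by unfold IsOddEnd; omega)] at this)
    have hs : HStrip μ κ := by
      rw [← halfRow_interlace_odd he hμ hκ (h := h), hrow]
      exact hr.2.2
    exact ⟨μ, by simpa using ⟨hs.le, hμ, hs⟩, hrow⟩
  · exact fun μ _ => patternsWith_soEntry_finite hh μ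

/-! ### The interpolating polynomial as a pattern sum. -/

section

variable (R : Type*) [CommRing R] {σ : Type*}

theorem rowSum_of_eq_halfRow {n h i : ℕ} {lam : ℕ →₀ ℕ} (hlam : LenLE n lam) {z : ℕ → ℕ → ℚ}
    (hi : (i + 1) / 2 = n) (hz : z i = halfRow n h 0 lam) :
    rowSum z i = lam.degree + n * h / 2 := by
  rw [rowSum, hi, hz, sum_halfRow hlam]

theorem weight_succ {n : ℕ} (x : Fin (n + 1) → σ) (r r' : ℕ → ℚ) (z : ℕ → ℕ → ℚ) :
    weight R x (addRow (2 * n + 1 + 1) r (addRow (2 * n + 1) r' z)) =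
      weight R (fun i => x i.castSucc) z *
        vpow R (x (Fin.last n)) (∑ j ∈ Finset.Icc 1 (n + 1), r j -
          2 * ∑ j ∈ Finset.Icc 1 (n + 1), r' j + rowSum z (2 * n)) := by
  unfold weight
  rw [Fin.prod_univ_castSucc]
  congr 1
  · refine Finset.prod_congr rfl fun i _ => ?_
    have := i.2
    unfold rowType
    simp only [Fin.val_castSucc]
    rw [rowSum_addRow_of_ne (by omega), rowSum_addRow_of_ne (by omega),
      rowSum_addRow_of_ne (by omega), rowSum_addRow_of_ne (by omega),
      rowSum_addRow_of_ne (by omega), rowSum_addRow_of_ne (by omega)]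
  · congr 1
    have e1 : rowSum (addRow (2 * n + 1 + 1) r (addRow (2 * n + 1) r' z)) (2 * (n + 1)) =
        ∑ j ∈ Finset.Icc 1 (n + 1), r j := by
      rw [rowSum, show 2 * (n + 1) = 2 * n + 1 + 1 by ring, addRow_self,
        show (2 * n + 1 + 1 + 1) / 2 = n + 1 by omega]
    have e2 : rowSum (addRow (2 * n + 1 + 1) r (addRow (2 * n + 1) r' z)) (2 * n + 1) =
        ∑ j ∈ Finset.Icc 1 (n + 1), r' j := by
      rw [rowSum_addRow_of_ne (by omega), rowSum, addRow_self,
        show (2 * n + 1 + 1) / 2 = n + 1 by omega]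
    have e3 : rowSum (addRow (2 * n + 1 + 1) r (addRow (2 * n + 1) r' z)) (2 * n) =
        rowSum z (2 * n) := by
      rw [rowSum_addRow_of_ne (by omega), rowSum_addRow_of_ne (by omega)]
    unfold rowType
    simp only [Fin.val_last]
    rw [show 2 * (n + 1) - 1 = 2 * n + 1 by omega, show 2 * n + 1 - 1 = 2 * n by omega, e1, e2, e3]
    ring

theorem atypCountOf_succ {n h e : ℕ} (hh : h ≤ 1) (he : e ≤ 1) {κ : ℕ →₀ ℕ}
    (hea : e ≤ κ n + h) (r : ℕ → ℚ) (z : ℕ → ℕ → ℚ) :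
    atypCountOf h (n + 1)
      (addRow (2 * n + 1 + 1) r (addRow (2 * n + 1) (halfRow (n + 1) h e κ) z)) =
      atypCountOf h n z + e := by
  classical
  unfold atypCountOf
  simp only [Finset.card_filter]
  rw [Finset.sum_Icc_succ_top (by omega)]
  congr 1
  · refine Finset.sum_congr rfl fun k hk => ?_
    have := Finset.mem_Icc.1 hk
    rw [addRow_of_ne (by omega), addRow_of_ne (by omega)]
  · rw [show 2 * (n + 1) - 1 = 2 * n + 1 by omega, addRow_of_ne (by omega), addRow_self,
      halfRow_last, isAtypicalEntry_iff hh he hea]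
    obtain rfl | rfl : e = 0 ∨ e = 1 := by omega
    · simp
    · simp

theorem finsum_soPatterns_eq_patternSum {h : ℕ} (hh : h ≤ 1) (β : R) :
    ∀ (n : ℕ) (x : Fin n → σ) (lam : ℕ →₀ ℕ), LenLE n lam →
    ∑ᶠ z ∈ patternsWith (2 * n) (soEntry h) (halfRow n h 0 lam),
      β ^ atypCountOf h n z • weight R x z =
    patternSum (varUnit R) (endWeight R h β) (List.ofFn x).reverse lam := by
  intro n
  induction n with
  | zero =>
    intro x lam _
    have : halfRow 0 h 0 lam = 0 := by
      funext j
      exact halfRow_of_not (by omega)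
    rw [this, Nat.mul_zero, patternsWith_zero, finsum_mem_singleton]
    simp [patternSum, atypCountOf, weight]
  | succ n ih =>
    intro x lam hlam
    rw [show 2 * (n + 1) = 2 * n + 1 + 1 by ring, finsum_soPatterns_odd_step hh hlam,
      List.ofFn_succ', List.concat_eq_append, List.reverse_append, List.reverse_singleton,
      List.singleton_append, patternSum_cons, List.length_reverse, List.length_ofFn]
    have h1 : ∀ a ∈ (Finset.Iic lam ×ˢ Finset.range 2).filter
        (fun a => HStrip a.1 lam ∧ a.2 ≤ a.1 n + h),
        ∑ᶠ z ∈ patternsWith (2 * n + 1) (soEntry h) (halfRow (n + 1) h a.2 a.1),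
          β ^ atypCountOf h (n + 1) (addRow (2 * n + 1 + 1) (halfRow (n + 1) h 0 lam) z) •
            weight R x (addRow (2 * n + 1 + 1) (halfRow (n + 1) h 0 lam) z) =
        ∑ μ ∈ (Finset.Iic lam).filter (LenLE n), if HStrip μ a.1 then
          patternSum (varUnit R) (endWeight R h β) (List.ofFn fun i => x i.castSucc).reverse μ *
            ((((varUnit R (x (Fin.last n))) ^ ((lam.degree : ℤ) - 2 * a.1.degree + μ.degree) :
              (Poly R σ)ˣ) : Poly R σ) * β ^ a.2 • vpow R (x (Fin.last n)) (a.2 - h / 2)) else 0 := by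
      rintro ⟨κ, e⟩ ha
      simp only [Finset.mem_filter, Finset.mem_product, Finset.mem_Iic, Finset.mem_range] at ha
      have hκ : LenLE (n + 1) κ := hlam.of_le ha.1.1
      have he : e ≤ 1 := by omega
      rw [finsum_soPatterns_even_step hh he hκ ha.2.2, ← Finset.sum_filter]
      have hset : (Finset.Iic κ).filter (fun μ => LenLE n μ ∧ HStrip μ κ) =
          ((Finset.Iic lam).filter (LenLE n)).filter (fun μ => HStrip μ κ) := by
        ext μ
        simp only [Finset.mem_filter, Finset.mem_Iic]
        exact ⟨fun hμ => ⟨⟨hμ.1.trans ha.1.1, hμ.2.1⟩, hμ.2.2⟩,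
          fun hμ => ⟨hμ.2.le, hμ.1.2, hμ.2⟩⟩
      rw [hset]
      refine Finset.sum_congr rfl fun μ hμ => ?_
      simp only [Finset.mem_filter, Finset.mem_Iic] at hμ
      rw [← ih _ _ hμ.1.2, finsum_mem_mul' _ _ (patternsWith_soEntry_finite hh μ)]
      refine finsum_mem_congr rfl fun z hz => ?_
      rw [atypCountOf_succ hh he ha.2.2, weight_succ, sum_halfRow hlam, sum_halfRow_succ hκ,
        rowSum_of_eq_halfRow hμ.1.2 (by omega) hz.2.2.2, val_varUnit_zpow, pow_add, mul_smul,
        mul_smul_comm, smul_mul_assoc, mul_smul_comm, ← vpow_add]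
      -- The half-integer shifts add up to `(n + 1)h/2 - 2((n + 1)h/2 - e/2) + nh/2 = e - h/2`, the
      -- exponent in `endWeight`.
      congr 4
      push_cast
      ring
    rw [Finset.sum_congr rfl h1, Finset.sum_comm]
    refine Finset.sum_congr rfl fun μ _ => ?_
    rw [rowKernel, Finset.mul_sum, Finset.sum_filter, Finset.sum_product]
    refine Finset.sum_congr rfl fun κ _ => ?_
    rw [endWeight, Finset.sum_filter, Finset.mul_sum]
    by_cases hs1 : HStrip μ κ <;> by_cases hs2 : HStrip κ lam
    · simp only [hs1, hs2, if_true, true_and, Finset.mul_sum]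
      refine Finset.sum_congr rfl fun e _ => ?_
      split_ifs <;> simp
    · simp [hs2]
    · simp [hs1]
    · simp [hs1]

/-- Peeling rows off the bottom lists the variables backwards; symmetry removes the reversal. -/
theorem transCB_eq_patternSum {n h : ℕ} (hh : h ≤ 1) (x : Fin n → σ) (β : R) {lam : ℕ →₀ ℕ}
    (hlam : LenLE n lam) : transCB R (fun i => (lam i : ℚ) + h / 2) x β =
      patternSum (varUnit R) (endWeight R h β) (List.ofFn x) lam := by
  rw [transCB, soGT_eq_patternsWith hh,
    patternSum_perm (rowKernelsCommute_endWeight R hh β) (List.reverse_perm (List.ofFn x)).symm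
      (by rwa [List.length_ofFn]), ← finsum_soPatterns_eq_patternSum R hh β n x lam hlam]
  refine finsum_mem_congr rfl fun z hz => ?_
  rw [atypCount_eq_atypCountOf hh hz.2.2.2]

end

/-! ### Symplectic patterns -/

theorem spGT_eq_patternsWith {N l : ℕ} (hl : (N + 1) / 2 = l) (lam : ℕ →₀ ℕ) :
    spGT N (fun i : Fin l => (lam i : ℚ)) =
      patternsWith N (fun _ _ => IsNonnegInt) (halfRow l 0 0 lam) := by
  ext z
  constructor
  · rintro ⟨h1, h2, h3, h4⟩
    refine ⟨h1, h2, h3, ?_⟩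
    funext j
    by_cases hj : 1 ≤ j ∧ j ≤ l
    · obtain ⟨i, rfl⟩ : ∃ i, j = i + 1 := ⟨j - 1, by omega⟩
      rw [halfRow_zero_succ (by omega), h4 ⟨i, by omega⟩]
      simp
    · rw [halfRow_of_not hj]
      exact h1 _ _ (by unfold Idx; omega)
  · rintro ⟨h1, h2, h3, h4⟩
    refine ⟨h1, h2, h3, fun j => ?_⟩
    rw [h4, halfRow_zero_succ j.2]
    simp

theorem soEntry_zero_of_isNonnegInt {i j : ℕ} {q : ℚ} (hq : IsNonnegInt q) : soEntry 0 i j q := by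
  unfold soEntry
  split_ifs
  · exact hq.isHalfNat
  · obtain ⟨k, rfl⟩ := hq
    exact ⟨k, by simp⟩

theorem mem_symplectic_iff {n : ℕ} {r : ℕ → ℚ} {z : ℕ → ℕ → ℚ} :
    z ∈ patternsWith (2 * n) (fun _ _ => IsNonnegInt) r ↔
      z ∈ patternsWith (2 * n) (soEntry 0) r ∧ atypCountOf 0 n z = 0 := by
  classical
  have hnot : ∀ q, IsNonnegHalfInt q → ¬ IsNonnegInt q := by
    rintro q ⟨k, rfl⟩ ⟨l, hl⟩
    have h1 : 2 * (k : ℚ) + 1 = 2 * l := by linarith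
    have h2 : 2 * k + 1 = 2 * l := by exact_mod_cast h1
    omega
  rw [atypCountOf, Finset.card_eq_zero, Finset.filter_eq_empty_iff]
  constructor
  · rintro ⟨h1, h2, h3, h4⟩
    refine ⟨⟨h1, fun i j hij => soEntry_zero_of_isNonnegInt (h2 i j hij), h3, h4⟩, ?_⟩
    rintro k hk (⟨-, h⟩ | ⟨h, -⟩)
    · have := Finset.mem_Icc.1 hk
      exact hnot _ h (h2 _ _ (by unfold Idx; omega))
    · omega
  · rintro ⟨⟨h1, h2, h3, h4⟩, h5⟩
    refine ⟨h1, fun i j hij => ?_, h3, h4⟩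
    have h6 := h2 i j hij
    unfold soEntry at h6
    split_ifs at h6 with ho
    · have hi : i = 2 * j - 1 := by unfold IsOddEnd at ho; omega
      have h7 := @h5 j (Finset.mem_Icc.2 (by unfold Idx at hij; omega))
      rw [← hi] at h7
      obtain ⟨k, hk⟩ := h6
      obtain ⟨a, rfl | rfl⟩ := Nat.even_or_odd' k
      · exact ⟨a, by rw [hk]; push_cast; ring⟩
      · exact absurd (Or.inl ⟨rfl, a, by rw [hk]; push_cast; ring⟩) h7
    · obtain ⟨k, hk⟩ := h6
      exact ⟨k, by simpa using hk⟩

/-! ### Symplectic polynomials as pattern sums. -/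

section

variable (R : Type*) [CommRing R] {σ : Type*}

theorem endWeight_zero_zero : endWeight R 0 (0 : R) = fun (_ : σ) _ => 1 := by
  funext v c
  rw [endWeight_zero]
  simp

theorem soOdd_eq_transCB {n : ℕ} (lam : Fin n → ℚ) (x : Fin n → σ) :
    soOdd R lam x = transCB R lam x 1 := by
  simp only [soOdd, transCB, one_pow, one_smul]

/-- At `β = 0` the factor `0 ^ atypCountOf` keeps exactly the patterns without atypical entries, and
these are the symplectic ones. -/
theorem spEven_eq_patternSum {n : ℕ} (x : Fin n → σ) {lam : ℕ →₀ ℕ} (hlam : LenLE n lam) :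
    spEven R (fun i => (lam i : ℚ)) x =
      patternSum (varUnit R) (fun _ _ => 1) (List.ofFn x) lam := by
  classical
  have h1 : ∀ l, l.Perm (List.ofFn x) → patternSum (varUnit R) (fun _ _ => 1) l lam =
      patternSum (varUnit R) (fun _ _ => 1) (List.ofFn x) lam := fun l hl =>
    patternSum_perm (rowKernelsCommute_const _ _) hl (by rwa [hl.length_eq, List.length_ofFn])
  rw [← h1 _ (List.reverse_perm _), ← endWeight_zero_zero,
    ← finsum_soPatterns_eq_patternSum R zero_le_one 0 n x lam hlam, spEven,
    spGT_eq_patternsWith (by omega)]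
  refine finsum_congr fun z => ?_
  simp only [finsum_eq_if, mem_symplectic_iff]
  by_cases hz : z ∈ patternsWith (2 * n) (soEntry 0) (halfRow n 0 0 lam) <;>
    by_cases ha : atypCountOf 0 n z = 0 <;> simp [hz, ha]

theorem weight_addRow {n : ℕ} (x : Fin n → σ) (r : ℕ → ℚ) (z : ℕ → ℕ → ℚ) :
    weight R x (addRow (2 * n + 1) r z) = weight R x z := by
  unfold weight rowType
  refine Finset.prod_congr rfl fun i _ => ?_
  have := i.2
  rw [rowSum_addRow_of_ne (by omega), rowSum_addRow_of_ne (by omega),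
    rowSum_addRow_of_ne (by omega)]

theorem spOdd_eq_oddPatternSum {n : ℕ} (x : Fin n → σ) (s : σ) {κ : ℕ →₀ ℕ}
    (hκ : LenLE (n + 1) κ) :
    spOdd R (fun i => (κ i : ℚ)) x s = oddPatternSum (varUnit R) (List.ofFn x) s κ := by
  rw [spOdd, spGT_eq_patternsWith (by omega),
    finsum_patternsWith_succ ((Finset.Iic κ).filter (fun μ => LenLE n μ ∧ HStrip μ κ))
      (halfRow n 0 0), oddPatternSum, List.length_ofFn, ← Finset.filter_filter,
      Finset.sum_filter]
  · refine Finset.sum_congr rfl fun μ hμ => ?_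
    have hμ' := (Finset.mem_filter.1 hμ).2
    rw [stripKernel_apply]
    split_ifs with hs
    · rw [val_varUnit_zpow, ← spEven_eq_patternSum R x hμ', spEven,
        spGT_eq_patternsWith (by omega), finsum_mem_mul' _ _ (by
          rw [← spGT_eq_patternsWith (by omega)]
          exact spGT_finite _ (by omega) _)]
      refine finsum_mem_congr rfl fun z hz => ?_
      rw [weight_addRow, rowType, Nat.add_sub_cancel, rowSum_addRow_of_ne (i := 2 * n) (by omega),
        rowSum_of_eq_halfRow hκ (by omega) (addRow_self _ _ _),
        rowSum_of_eq_halfRow hμ' (by omega) hz.2.2.2]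
      simp
    · rw [mul_zero]
  · exact (halfRow_zero_injOn n 0).mono fun μ hμ => (Finset.mem_filter.1 hμ).2.1
  · intro μ hμ
    simp only [Finset.mem_filter] at hμ
    refine ⟨fun j hj => ?_, fun j hj => halfRow_of_not (by unfold Idx at hj; omega),
      (halfRow_interlace_odd zero_le_one hμ.2.1 hκ).2 hμ.2.2⟩
    obtain ⟨i, rfl⟩ : ∃ i, j = i + 1 := ⟨j - 1, by unfold Idx at hj; omega⟩
    exact ⟨κ i, by rw [halfRow_zero_succ (by unfold Idx at hj; omega)]; simp⟩
  · rintro r' z' hr ⟨h1, h2, h3, rfl⟩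
    obtain ⟨μ, hμ, hrow⟩ := exists_halfRow_zero (l := n) (h := 0) (r := z' (2 * n))
      (fun j hj => h1 _ _ (by unfold Idx; omega))
      (fun j hj hj' => by
        obtain ⟨k, hk⟩ := h2 (2 * n) j (by unfold Idx; omega)
        exact ⟨k, by simp [hk]⟩)
    have hs : HStrip μ κ := by
      rw [← halfRow_interlace_odd zero_le_one hμ hκ (h := 0), hrow]
      exact hr.2.2
    exact ⟨μ, by simpa using ⟨hs.le, hμ, hs⟩, hrow⟩
  · intro μ _
    rw [← spGT_eq_patternsWith (by omega)]
    exact spGT_finite _ (by omega) _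

end

/-! ### Sums over partitions contained in a rectangle -/

theorem antitone_of_patternSum_ne_zero {A σ : Type*} [CommRing A] {U : σ → Aˣ} {g : σ → ℕ → A}
    {l : List σ} {lam : ℕ →₀ ℕ} (hl : l ≠ []) (h : patternSum U g l lam ≠ 0) (j : ℕ) :
    lam (j + 1) ≤ lam j := by
  obtain ⟨v, l, rfl⟩ := List.exists_cons_of_ne_nil hl
  rw [patternSum_cons] at h
  obtain ⟨μ, -, hμ⟩ := Finset.exists_ne_zero_of_sum_ne_zero h
  obtain ⟨κ, -, hκ⟩ := Finset.exists_ne_zero_of_sum_ne_zero (right_ne_zero_of_mul hμ)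
  have := (ite_ne_right_iff.1 hκ).1.2 j
  exact this.1.trans this.2

theorem antitone_of_oddPatternSum_ne_zero {A σ : Type*} [CommRing A] {U : σ → Aˣ}
    {l : List σ} {s : σ} {lam : ℕ →₀ ℕ} (h : oddPatternSum U l s lam ≠ 0) (j : ℕ) :
    lam (j + 1) ≤ lam j := by
  obtain ⟨μ, -, hμ⟩ := Finset.exists_ne_zero_of_sum_ne_zero h
  have h1 := right_ne_zero_of_mul hμ
  rw [stripKernel_apply] at h1
  have := (ite_ne_right_iff.1 h1).1 j
  exact this.1.trans this.2

theorem antitone_fin_iff {m h : ℕ} {lam : ℕ →₀ ℕ} (hlam : LenLE m lam) :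
    Antitone (fun i : Fin m => (lam i : ℚ) + h / 2) ↔ ∀ j, lam (j + 1) ≤ lam j := by
  constructor
  · intro H j
    by_cases hj : j + 1 < m
    · have := H (a := ⟨j, by omega⟩) (b := ⟨j + 1, hj⟩) (by simp)
      exact add_half_le_iff.1 this
    · rw [hlam (j + 1) (by omega)]
      exact Nat.zero_le _
  · intro H i j hij
    exact add_half_le_iff.2 (antitone_nat_of_succ_le H hij)

theorem rect_add_half_iff {m h k : ℕ} (hm : 1 ≤ m) (hh : h ≤ 1) :
    (IsPartition (rect m ((k : ℚ) + h / 2)) ↔ h = 0) ∧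
      (IsHalfPartition (rect m ((k : ℚ) + h / 2)) ↔ h = 1) := by
  have ha : Antitone (rect m ((k : ℚ) + h / 2)) := fun _ _ _ => le_rfl
  refine ⟨⟨fun H => (isNonnegInt_add_half hh).1 (H.2 ⟨0, hm⟩), fun H =>
    ⟨ha, fun _ => (isNonnegInt_add_half hh).2 H⟩⟩,
    ⟨fun H => (isNonnegHalfInt_add_half hh).1 (H.2 ⟨0, hm⟩), fun H =>
    ⟨ha, fun _ => (isNonnegHalfInt_add_half hh).2 H⟩⟩⟩

theorem subPartitions_rect {m h : ℕ} (hm : 1 ≤ m) (hh : h ≤ 1) (k : ℕ) :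
    subPartitions (rect m ((k : ℚ) + h / 2)) =
      (fun (lam : ℕ →₀ ℕ) (i : Fin m) => (lam i : ℚ) + h / 2) ''
        {lam | lam ∈ rowBox m k ∧ ∀ j, lam (j + 1) ≤ lam j} := by
  have hr := rect_add_half_iff (k := k) hm hh
  ext f
  rw [subPartitions, Set.mem_ofPred_eq, hr.1, hr.2]
  constructor
  · rintro ⟨h1, h2⟩
    have h3 : Antitone f ∧ ∀ i, ∃ a : ℕ, f i = a + h / 2 := by
      rcases h1 with ⟨rfl, h1⟩ | ⟨rfl, h1⟩
      · exact ⟨h1.1, fun i => by obtain ⟨a, ha⟩ := h1.2 i; exact ⟨a, by simp [ha]⟩⟩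
      · exact ⟨h1.1, fun i => by obtain ⟨a, ha⟩ := h1.2 i; exact ⟨a, by simp [ha]⟩⟩
    obtain ⟨h3, h4⟩ := h3
    choose a ha using h4
    let lam : ℕ →₀ ℕ := Finsupp.onFinset (Finset.range m)
      (fun j => if hj : j < m then a ⟨j, hj⟩ else 0) (fun j hj => by
        by_contra hn
        simp only [Finset.mem_range] at hn
        simp [hn] at hj)
    have hlam : ∀ i : Fin m, lam i = a i := fun i => by simp [lam]
    have hf : (fun i : Fin m => (lam i : ℚ) + h / 2) = f := by
      funext i
      rw [hlam, ha]
    have hlen : LenLE m lam := fun j hj => by simp [lam, show ¬ j < m by omega]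
    refine ⟨lam, ⟨mem_rowBox.2 ⟨hlen, fun j => ?_⟩, ?_⟩, hf⟩
    · by_cases hj : j < m
      · have := h2 ⟨j, hj⟩
        rw [← hf] at this
        exact add_half_le_iff.1 this
      · rw [hlen j (by omega)]
        exact Nat.zero_le _
    · rw [← antitone_fin_iff hlen (h := h), hf]
      exact h3
  · rintro ⟨lam, ⟨h1, h2⟩, rfl⟩
    obtain ⟨h3, h4⟩ := mem_rowBox.1 h1
    have h5 := (antitone_fin_iff h3 (h := h)).2 h2
    refine ⟨?_, fun i => add_half_le_iff.2 (h4 i)⟩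
    obtain rfl | rfl : h = 0 ∨ h = 1 := by omega
    · exact Or.inl ⟨rfl, h5, fun i => ⟨lam i, by simp⟩⟩
    · exact Or.inr ⟨rfl, h5, fun i => ⟨lam i, by simp⟩⟩

/-- `rowBox` also contains rows that are not weakly decreasing; `hF` makes them contribute zero. -/
theorem finsum_subPartitions_rect {A : Type*} [AddCommMonoid A] {m h : ℕ} (hm : 1 ≤ m)
    (hh : h ≤ 1) (k : ℕ) (F : (Fin m → ℚ) → A)
    (hF : ∀ lam ∈ rowBox m k, F (fun i => (lam i : ℚ) + h / 2) ≠ 0 → ∀ j, lam (j + 1) ≤ lam j) :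
    ∑ᶠ lam ∈ subPartitions (rect m ((k : ℚ) + h / 2)), F lam =
      ∑ lam ∈ rowBox m k, F (fun i => (lam i : ℚ) + h / 2) := by
  classical
  rw [subPartitions_rect hm hh, finsum_mem_image, ← Finset.sum_filter_of_ne hF,
    ← finsum_mem_coe_finset, Finset.coe_filter]
  rintro lam ⟨h1, -⟩ lam' ⟨h1', -⟩ H
  ext j
  by_cases hj : j < m
  · have := congrFun H ⟨j, hj⟩
    simpa using this
  · rw [(mem_rowBox.1 h1).1 j (by omega), (mem_rowBox.1 h1').1 j (by omega)]

theorem rect_eq_preRow (m h k : ℕ) :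
    rect m ((k : ℚ) + h / 2) = fun i : Fin m => (preRow m k 0 i : ℚ) + h / 2 := by
  funext i
  rw [preRow_apply, if_pos i.2, rect]

theorem prependRect_eq_preRow {k l n : ℕ} (hn : n = k + l) (u h : ℕ) (lam : ℕ →₀ ℕ) :
    prependRect hn ((u : ℚ) + h / 2) (fun i : Fin l => (lam i : ℚ) + h / 2) =
      fun i : Fin n => (preRow k u lam i : ℚ) + h / 2 := by
  subst hn
  funext i
  rw [prependRect, preRow_apply, Fin.cast_refl]
  induction i using Fin.addCases with
  | left i => simp [rect]
  | right i => simp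

/-! ### The identities for rectangular shapes. -/

section

variable (R : Type*) [CommRing R] {σ : Type*}

theorem transCB_rect_append {n m : ℕ} (hm : 1 ≤ m) (hnm : m ≤ n) (x : Fin n → σ) (y : Fin m → σ)
    (β : R) {u : ℚ} (hu : IsHalfNat u) :
    transCB R (rect (n + m) u) (Fin.append x y) β =
      ∑ᶠ lam ∈ subPartitions (rect m u),
        transCB R (prependRect (Nat.sub_add_cancel hnm).symm u lam) x β * transCB R lam y β := by
  -- Here `k` is the integer part of `u` and `h` the parity of `2u`.
  obtain ⟨k, h, hh, rfl⟩ : ∃ k h : ℕ, h ≤ 1 ∧ u = k + h / 2 := by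
    obtain ⟨a, rfl⟩ := hu
    refine ⟨a / 2, a % 2, by omega, ?_⟩
    have h1 : (2 * (a / 2 : ℕ) + (a % 2 : ℕ) : ℚ) = a := by exact_mod_cast Nat.div_add_mod a 2
    linarith
  have hy : (List.ofFn y).length = m := List.length_ofFn
  have hx : (List.ofFn x).length = n := List.length_ofFn
  have hbox : ∀ lam ∈ rowBox m k, LenLE n (preRow (n - m) k lam) := fun lam hlam => by
    have := (mem_rowBox.1 hlam).1.preRow (n - m) k
    rwa [Nat.sub_add_cancel hnm] at this
  have hrect : LenLE (n + m) (preRow (n + m) k 0) := fun j hj => by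
    rw [preRow_apply, if_neg (by omega)]; rfl
  have hc := rowKernelsCommute_endWeight R (σ := σ) hh β
  rw [finsum_subPartitions_rect hm hh]
  -- The head of the list belongs to the last rows, so the two groups are swapped to put `y` on the
  -- last `2m` rows.
  · rw [rect_eq_preRow, transCB_eq_patternSum R hh _ _ hrect, List.ofFn_fin_append,
      patternSum_perm hc List.perm_append_comm (by rwa [List.length_append, hx, hy])]
    have := patternSum_append_rect hc k (n - m) (List.ofFn y) (List.ofFn x) (by omega)
    rw [hx, hy, add_comm m n] at this
    rw [this]
    refine Finset.sum_congr rfl fun lam hlam => ?_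
    rw [prependRect_eq_preRow, transCB_eq_patternSum R hh _ _ (hbox lam hlam),
      transCB_eq_patternSum R hh _ _ (mem_rowBox.1 hlam).1]
  · intro lam hlam hne
    have h1 := right_ne_zero_of_mul hne
    rw [transCB_eq_patternSum R hh _ _ (mem_rowBox.1 hlam).1] at h1
    -- The empty pattern sum is 1 on every row, so `1 ≤ m` is needed to exclude the empty list.
    refine antitone_of_patternSum_ne_zero (fun h0 => ?_) h1
    rw [h0] at hy
    simp at hy
    omega

theorem spEven_eq_transCB {n : ℕ} (x : Fin n → σ) {lam : ℕ →₀ ℕ} (hlam : LenLE n lam) :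
    spEven R (fun i => (lam i : ℚ)) x = transCB R (fun i => (lam i : ℚ)) x 0 := by
  have := transCB_eq_patternSum R zero_le_one x 0 hlam
  rw [endWeight_zero_zero, ← spEven_eq_patternSum R x hlam] at this
  simpa using this.symm

theorem spEven_rect_append {n m : ℕ} (hm : 1 ≤ m) (hnm : m ≤ n) (x : Fin n → σ) (y : Fin m → σ)
    (u : ℕ) : spEven R (rect (n + m) u) (Fin.append x y) =
        ∑ᶠ lam ∈ subPartitions (rect m u),
          spEven R (prependRect (Nat.sub_add_cancel hnm).symm u lam) x * spEven R lam y := by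
  have hrect : LenLE (n + m) (preRow (n + m) u 0) := fun j hj => by
    rw [preRow_apply, if_neg (by omega)]; rfl
  have h1 := transCB_rect_append R hm hnm x y 0 (u := u) ⟨2 * u, by push_cast; ring⟩
  have h2 := rect_eq_preRow (n + m) 0 u
  have h3 := subPartitions_rect (h := 0) hm zero_le_one u
  simp only [Nat.cast_zero, zero_div, add_zero] at h2 h3
  rw [h2, spEven_eq_transCB R _ hrect, ← h2, h1]
  refine finsum_mem_congr rfl fun lam hlam => ?_
  rw [h3] at hlam
  obtain ⟨lam, ⟨hlam, -⟩, rfl⟩ := hlam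
  have h4 := prependRect_eq_preRow (Nat.sub_add_cancel hnm).symm u 0 lam
  simp only [Nat.cast_zero, zero_div, add_zero] at h4
  have h5 := (mem_rowBox.1 hlam).1.preRow (n - m) u
  rw [Nat.sub_add_cancel hnm] at h5
  simp only [h4]
  rw [spEven_eq_transCB R _ h5, spEven_eq_transCB R _ (mem_rowBox.1 hlam).1]

theorem spEven_rect_append_append {n m : ℕ} (hn : n + 1 = n - m + (m + 1))
    (x : Fin n → σ) (y : Fin m → σ) (s : σ) (u : ℕ) :
    spEven R (rect (n + m + 1) u) (Fin.append (Fin.append x y) ![s]) =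
      vpow R s (-u) *
        ∑ᶠ lam ∈ subPartitions (rect (m + 1) u),
          spOdd R (prependRect hn u lam) x s * spOdd R lam y s := by
  have hy : (List.ofFn y).length = m := List.length_ofFn
  have hx : (List.ofFn x).length = n := List.length_ofFn
  have hrect : LenLE (n + m + 1) (preRow (n + m + 1) u 0) := fun j hj => by
    rw [preRow_apply, if_neg (by omega)]; rfl
  have h2 := rect_eq_preRow (n + m + 1) 0 u
  have h3 := fun F hF => finsum_subPartitions_rect (A := Poly R σ) (m := m + 1) (h := 0) (by omega)
    zero_le_one u F hF
  have h4 := fun lam => prependRect_eq_preRow hn u 0 lam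
  simp only [Nat.cast_zero, zero_div, add_zero] at h2 h3 h4
  -- Symmetry moves `s` between the two groups, where the pattern is cut.
  have hperm : (List.ofFn (Fin.append (Fin.append x y) ![s])).Perm
      (List.ofFn y ++ s :: List.ofFn x) := by
    rw [List.ofFn_fin_append, List.ofFn_fin_append]
    simp only [List.ofFn_succ, List.ofFn_zero, Matrix.cons_val_zero]
    exact ((List.perm_append_comm).append_right _).trans
      (by rw [List.append_assoc]; exact List.Perm.append_left _ List.perm_append_comm)
  have h5 : vpow R s (-u) = ((varUnit R s ^ (-u : ℤ) : (Poly R σ)ˣ) : Poly R σ) := by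
    rw [val_varUnit_zpow]
    simp
  have h6 := patternSum_append_cons_rect (varUnit R) u (n - m) (List.ofFn y) (List.ofFn x) s
    (by omega)
  rw [hx, hy, add_comm m n] at h6
  rw [h3]
  · rw [h2, spEven_eq_patternSum R _ hrect, patternSum_perm (rowKernelsCommute_const _ _) hperm
      (by rwa [List.length_ofFn]), h6, h5]
    refine congrArg _ (Finset.sum_congr rfl fun lam hlam => ?_)
    have h7 := (mem_rowBox.1 hlam).1.preRow (n - m) u
    rw [← hn] at h7
    rw [h4, spOdd_eq_oddPatternSum R _ _ h7, spOdd_eq_oddPatternSum R _ _ (mem_rowBox.1 hlam).1]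
  · intro lam hlam hne
    have h1 := right_ne_zero_of_mul hne
    rw [spOdd_eq_oddPatternSum R _ _ (mem_rowBox.1 hlam).1] at h1
    exact antitone_of_oddPatternSum_ne_zero h1

end

end CBSchur

open CBSchur in
theorem mainTheorem7 (R : Type*) [CommRing R] {σ : Type*} (n m : ℕ) (hm : 1 ≤ m) (hnm : m ≤ n)
    (x : Fin n → σ) (y : Fin m → σ) (s : σ) :
    (∀ (β : R) (u : ℚ), IsHalfNat u →
      transCB R (rect (n + m) u) (Fin.append x y) β =
        ∑ᶠ lam ∈ subPartitions (rect m u),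
          transCB R (prependRect (Nat.sub_add_cancel hnm).symm u lam) x β * transCB R lam y β) ∧
    (∀ u : ℕ,
      spEven R (rect (n + m) u) (Fin.append x y) =
        ∑ᶠ lam ∈ subPartitions (rect m u),
          spEven R (prependRect (Nat.sub_add_cancel hnm).symm u lam) x * spEven R lam y) ∧
    (∀ u : ℚ, IsHalfNat u →
      soOdd R (rect (n + m) u) (Fin.append x y) =
        ∑ᶠ lam ∈ subPartitions (rect m u),
          soOdd R (prependRect (Nat.sub_add_cancel hnm).symm u lam) x * soOdd R lam y) ∧
    (∀ u : ℕ,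
      spEven R (rect (n + m + 1) u) (Fin.append (Fin.append x y) ![s]) =
        vpow R s (-u) *
          ∑ᶠ lam ∈ subPartitions (rect (m + 1) u),
            spOdd R (prependRect (k := n - m) (by omega) u lam) x s * spOdd R lam y s) := by
  refine ⟨fun β u hu => transCB_rect_append R hm hnm x y β hu,
    fun u => spEven_rect_append R hm hnm x y u, fun u hu => ?_,
    fun u => spEven_rect_append_append R _ x y s u⟩
  simp only [soOdd_eq_transCB]
  exact transCB_rect_append R hm hnm x y 1 hu
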